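/- Let $E>0$. For $h>0$ consider, for equal charges ($Z_-=0$), the angular operator $$K_\eta(h)=-h^2\partial_\eta^2+E\cos^2\eta$$ on $[-\pi,\pi]$ with periodic boundary conditions $\psi(-\pi)=\psi(\pi)$, $\psi'(-\pi)=\psi'(\pi)$. Its eigenvalues with an even eigenfunction and its eigenvalues with an odd eigenfunction form two strictly increasing infinite sequences $$\mu_0^+(h,E,0)<\mu_1^+(h,E,0)<\cdots,\qquad \mu_0^-(h,E,0)<\mu_1^-(h,E,0)<\cdots,$$ respectively, both indexed from $n=0$. For every $n\in\{0,1,2,\dots\}$, as $h\searrow 0$, $$\mu_n^+(h,E,0)=(2n+1)\sqrt{E}\,h+O(h^2),\qquad \mu_n^-(h,E,0)=(2n+1)\sqrt{E}\,h+O(h^2),$$ where the constants in $O(h^2)$ may depend on $n$ and $E$. -/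

import Mathlib

open Filter Topology Asymptotics

namespace TwoCenters

/-- The angular operator `K_η = -h² ∂_η² + Z₋ cos η + E cos² η`. -/
noncomputable def angularOp (h E Zm : ℝ) (ψ : ℝ → ℝ) (η : ℝ) : ℝ :=
  -h ^ 2 * deriv (deriv ψ) η + (Zm * Real.cos η + E * Real.cos η ^ 2) * ψ η

/-- `ψ` is a (real) eigenfunction of the angular operator with eigenvalue `μ` for periodic boundary
conditions on `[-π, π]`: a nonzero `2π`-periodic `C²` solution of `K_η ψ = μ ψ`.
Since the coefficients are `2π`-periodic, solutions on `[-π, π]` with `ψ(-π) = ψ(π)` and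
`ψ'(-π) = ψ'(π)` are the same thing as `2π`-periodic solutions on the line. -/
structure IsAngularEigenfunction (h E Zm μ : ℝ) (ψ : ℝ → ℝ) : Prop where
  contDiff : ContDiff ℝ 2 ψ
  periodic : Function.Periodic ψ (2 * Real.pi)
  ne_zero : ψ ≠ 0
  eigen : ∀ η, angularOp h E Zm ψ η = μ * ψ η

/-- The eigenvalues of the angular operator on the even functions. -/
def evenSpectrum (h E Zm : ℝ) : Set ℝ :=
  {μ | ∃ ψ, IsAngularEigenfunction h E Zm μ ψ ∧ Function.Even ψ}

/-- The eigenvalues of the angular operator on the odd functions. -/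
def oddSpectrum (h E Zm : ℝ) : Set ℝ :=
  {μ | ∃ ψ, IsAngularEigenfunction h E Zm μ ψ ∧ Function.Odd ψ}

/-- The elements of a set of reals listed in increasing order, starting with index `0`
(meaningful for sets that can be listed as `s₀ < s₁ < s₂ < ⋯`). -/
noncomputable def nthSmallest (S : Set ℝ) : ℕ → ℝ
  | 0 => sInf S
  | n + 1 => sInf (S ∩ Set.Ioi (nthSmallest S n))

/-- `μ_n⁺(h, E, Z₋)`, `n = 0, 1, 2, …`: the eigenvalues with even eigenfunctions, in increasing
order. Each of them is simple on the even functions, so that there are no repetitions. -/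
noncomputable def muPlus (n : ℕ) (h E Zm : ℝ) : ℝ := nthSmallest (evenSpectrum h E Zm) n

/-- `μ_n⁻(h, E, Z₋)`, `n = 0, 1, 2, …`: the eigenvalues with odd eigenfunctions, in increasing
order. Each of them is simple on the odd functions, so that there are no repetitions. For `Z₋ = 0`
this is the one that belongs to the Mathieu sine `se_{n+1}`. -/
noncomputable def muMinus (n : ℕ) (h E Zm : ℝ) : ℝ := nthSmallest (oddSpectrum h E Zm) n

end TwoCenters

/-!
The Prüfer angle at `π` of the solution that is even (odd) at `0` increases strictly and
continuously with the energy, and the even (odd) eigenvalues are the energies at which it is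
`π / 2` (`0`) modulo `π`; so they form an increasing sequence indexed by the number of half turns,
and bounds on them follow from comparison of angles. Since the Neumann problem on `[0, π]` lies
below the Dirichlet problem, `μ_n⁺ ≤ μ_n⁻`, and one upper and one lower bound suffice.

For the upper bound, `cos² ≤ cot²` replaces the well at `π / 2` by the Pöschl–Teller well, which is
solved by `sin ^ s` times a Gegenbauer polynomial in `cos`. For the lower bound, `tanh² ≤ sin²` on
`[0, 1]` replaces the well, moved to the origin, by the modified Pöschl–Teller well, solved by
`cosh ^ (-s)` times a polynomial in `sinh`; beyond distance `1` the potential exceeds the energy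
so much that comparison with a Gaussian leaves no room for another half turn.
-/

namespace SturmLiouville

open Set Real
open scoped NNReal

section Calculus

variable {f f' : ℝ → ℝ} {a b : ℝ}

lemma deriv_nonneg_of_forall_le_right {d : ℝ} (hf : HasDerivAt f d a) (hab : a < b)
    (h : ∀ x ∈ Ioo a b, f a ≤ f x) : 0 ≤ d := by
  have hslope : Tendsto (slope f a) (𝓝[>] a) (𝓝 d) :=
    (hasDerivWithinAt_iff_tendsto_slope' self_notMem_Ioi).1 hf.hasDerivWithinAt
  refine ge_of_tendsto hslope ?_
  filter_upwards [Ioo_mem_nhdsGT hab] with x hx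
  exact (slope_nonneg_iff_of_le hx.1.le).2 (h x hx)

lemma deriv_nonpos_of_forall_le_left {d : ℝ} (hf : HasDerivAt f d b) (hab : a < b)
    (h : ∀ x ∈ Ioo a b, f b ≤ f x) : d ≤ 0 := by
  have hslope : Tendsto (slope f b) (𝓝[<] b) (𝓝 d) :=
    (hasDerivWithinAt_iff_tendsto_slope' self_notMem_Iio).1 hf.hasDerivWithinAt
  refine le_of_tendsto hslope ?_
  filter_upwards [Ioo_mem_nhdsLT hab] with x hx
  rw [slope_comm]
  exact (slope_nonpos_iff_of_le hx.2.le).2 (h x hx)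

lemma pos_or_neg_of_ne_zero (hf : ContinuousOn f (Ioo a b)) (h : ∀ x ∈ Ioo a b, f x ≠ 0) :
    (∀ x ∈ Ioo a b, 0 < f x) ∨ ∀ x ∈ Ioo a b, f x < 0 := by
  by_contra! hcon
  obtain ⟨⟨x, hx, hfx⟩, y, hy, hfy⟩ := hcon
  obtain ⟨z, hz, hz0⟩ := isPreconnected_Ioo.intermediate_value hx hy hf ⟨hfx, hfy⟩
  exact h z hz hz0

lemma exists_consecutive_zeros (hf : ContinuousOn f (Icc a b)) (ha : f a = 0) (hb : f b = 0)
    {c : ℝ} (hc : c ∈ Ioo a b) (hfc : f c ≠ 0) :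
    ∃ α ∈ Icc a b, ∃ β ∈ Icc a b, α < β ∧ f α = 0 ∧ f β = 0 ∧ ∀ x ∈ Ioo α β, f x ≠ 0 := by
  have hfac := hf.mono (Icc_subset_Icc_right hc.2.le)
  have hfcb := hf.mono (Icc_subset_Icc_left hc.1.le)
  obtain ⟨α, ⟨hα, hα0⟩, hαmax⟩ := (isCompact_Icc.of_isClosed_subset
    (hfac.preimage_isClosed_of_isClosed isClosed_Icc isClosed_singleton)
    inter_subset_left).exists_isGreatest ⟨a, left_mem_Icc.2 hc.1.le, ha⟩
  obtain ⟨β, ⟨hβ, hβ0⟩, hβmin⟩ := (isCompact_Icc.of_isClosed_subset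
    (hfcb.preimage_isClosed_of_isClosed isClosed_Icc isClosed_singleton)
    inter_subset_left).exists_isLeast ⟨b, right_mem_Icc.2 hc.2.le, hb⟩
  have hαc : α < c := lt_of_le_of_ne hα.2 (by rintro rfl; exact hfc hα0)
  have hcβ : c < β := lt_of_le_of_ne hβ.1 (by rintro rfl; exact hfc hβ0)
  refine ⟨α, ⟨hα.1, hα.2.trans hc.2.le⟩, β, ⟨hc.1.le.trans hβ.1, hβ.2⟩, hαc.trans hcβ, hα0, hβ0,
    fun x hx h0 => ?_⟩
  rcases le_total x c with hxc | hcx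
  · exact (hαmax ⟨⟨hα.1.trans hx.1.le, hxc⟩, h0⟩).not_gt hx.1
  · exact (hβmin ⟨⟨hcx, hx.2.le.trans hβ.2⟩, h0⟩).not_gt hx.2

lemma exists_finset_deriv_eq_zero (hf : ∀ x, HasDerivAt f (f' x) x) (S : Finset ℝ)
    (hS : ∀ x ∈ S, f x = 0) :
    ∃ T : Finset ℝ, S.card ≤ T.card + 1 ∧
      ∀ t ∈ T, f' t = 0 ∧ ∃ x ∈ S, ∃ y ∈ S, t ∈ Ioo x y := by
  have rolle : ∀ x y, ∃ t, x ∈ S → y ∈ S → x < y → t ∈ Ioo x y ∧ f' t = 0 := by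
    intro x y
    by_cases h : x ∈ S ∧ y ∈ S ∧ x < y
    · obtain ⟨t, ht⟩ := exists_hasDerivAt_eq_zero h.2.2
        (fun z _ => (hf z).continuousAt.continuousWithinAt)
        ((hS x h.1).trans (hS y h.2.1).symm) fun z _ => hf z
      exact ⟨t, fun _ _ _ => ht⟩
    · exact ⟨0, fun hx hy hxy => absurd ⟨hx, hy, hxy⟩ h⟩
  choose w hw using rolle
  refine ⟨((S ×ˢ S).filter fun p => p.1 < p.2).image fun p => w p.1 p.2,
    Finset.card_le_of_interleaved fun x hx y hy hxy _ => ⟨w x y, ?_, (hw x y hx hy hxy).1⟩, ?_⟩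
  · exact Finset.mem_image.2 ⟨(x, y), by simp [hx, hy, hxy], rfl⟩
  · simp only [Finset.mem_image, Finset.mem_filter, Finset.mem_product, Prod.exists]
    rintro _ ⟨x, y, ⟨⟨hx, hy⟩, hxy⟩, rfl⟩
    exact ⟨(hw x y hx hy hxy).2, x, hx, y, hy, (hw x y hx hy hxy).1⟩

end Calculus

section Solutions

/-- `(y, y')` is a solution of `y'' = -Q y` on the line, written as a first order system. -/
def IsSolution (Q y y' : ℝ → ℝ) : Prop :=
  ∀ x, HasDerivAt y (y' x) x ∧ HasDerivAt y' (-Q x * y x) x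

variable {Q y y' z z' : ℝ → ℝ}

lemma IsSolution.continuous (hy : IsSolution Q y y') : Continuous y :=
  continuous_iff_continuousAt.2 fun x => (hy x).1.continuousAt

lemma IsSolution.continuous_deriv (hy : IsSolution Q y y') : Continuous y' :=
  continuous_iff_continuousAt.2 fun x => (hy x).2.continuousAt

lemma IsSolution.neg (hy : IsSolution Q y y') :
    IsSolution Q (fun x => -y x) (fun x => -y' x) := fun x =>
  ⟨(hy x).1.neg, (hy x).2.neg.congr_deriv (by ring)⟩

lemma IsSolution.comp_const_sub (hy : IsSolution Q y y') (c : ℝ) :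
    IsSolution (fun x => Q (c - x)) (fun x => y (c - x)) (fun x => -y' (c - x)) := fun x =>
  ⟨(hy (c - x)).1.comp_const_sub c x,
    ((hy (c - x)).2.comp_const_sub c x).neg.congr_deriv (by ring)⟩

lemma IsSolution.wronskian_eq (hy : IsSolution Q y y') (hz : IsSolution Q z z') (s t : ℝ) :
    y' s * z s - y s * z' s = y' t * z t - y t * z' t := by
  have hW : ∀ x, HasDerivAt (fun x => y' x * z x - y x * z' x) 0 x := fun x =>
    (((hy x).2.mul (hz x).1).sub ((hy x).1.mul (hz x).2)).congr_deriv (by ring)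
  exact is_const_of_deriv_eq_zero (fun x => (hW x).differentiableAt) (fun x => (hW x).deriv) s t

end Solutions

section SturmComparison

variable {Q q y y' u u' : ℝ → ℝ} {a b : ℝ}

/-- The Wronskian `y' u - y u'` decreases strictly, but `u y > 0` in between makes it nonpositive at
`a` and nonnegative at `b`. -/
lemma not_forall_mul_pos (hy : IsSolution Q y y') (hu : ∀ x ∈ Icc a b, HasDerivAt u (u' x) x)
    (hu'c : ContinuousOn u' (Icc a b)) (hu' : ∀ x ∈ Ioo a b, HasDerivAt u' (-q x * u x) x)
    (hq : ∀ x ∈ Ioo a b, q x < Q x) (hab : a < b) (ha : u a = 0) (hb : u b = 0) :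
    ¬∀ x ∈ Ioo a b, 0 < u x * y x := by
  intro hpos
  have huc : ContinuousOn u (Icc a b) := fun x hx => (hu x hx).continuousAt.continuousWithinAt
  have wronskian_anti : StrictAntiOn (fun x => y' x * u x - y x * u' x) (Icc a b) := by
    refine strictAntiOn_of_deriv_neg (convex_Icc a b)
      ((hy.continuous_deriv.continuousOn.mul huc).sub (hy.continuous.continuousOn.mul hu'c))
      fun x hx => ?_
    rw [interior_Icc] at hx
    have hd : HasDerivAt (fun x => y' x * u x - y x * u' x) (-((Q x - q x) * (u x * y x))) x :=
      (((hy x).2.mul (hu x (Ioo_subset_Icc_self hx))).sub ((hy x).1.mul (hu' x hx))).congr_deriv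
        (by ring)
    rw [hd.deriv, neg_neg_iff_pos]
    exact mul_pos (sub_pos.2 (hq x hx)) (hpos x hx)
  have product_deriv : ∀ x ∈ Icc a b,
      HasDerivAt (fun x => u x * y x) (u' x * y x + u x * y' x) x := fun x hx =>
    (hu x hx).mul (hy x).1
  have ha' := deriv_nonneg_of_forall_le_right (product_deriv a (left_mem_Icc.2 hab.le)) hab
    fun x hx => by simpa only [ha, zero_mul] using (hpos x hx).le
  have hb' := deriv_nonpos_of_forall_le_left (product_deriv b (right_mem_Icc.2 hab.le)) hab
    fun x hx => by simpa only [hb, zero_mul] using (hpos x hx).le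
  have hlt := wronskian_anti (left_mem_Icc.2 hab.le) (right_mem_Icc.2 hab.le) hab
  simp only [ha, hb, mul_zero, zero_mul, add_zero, zero_sub] at hlt ha' hb'
  linarith

/-- **Sturm's comparison theorem**. The potential `q` may be singular at `a` and at `b`. -/
theorem sturm_comparison (hy : IsSolution Q y y') (hu : ∀ x ∈ Icc a b, HasDerivAt u (u' x) x)
    (hu'c : ContinuousOn u' (Icc a b)) (hu' : ∀ x ∈ Ioo a b, HasDerivAt u' (-q x * u x) x)
    (hq : ∀ x ∈ Ioo a b, q x < Q x) (ha : u a = 0) (hb : u b = 0)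
    (hu0 : ∃ c ∈ Ioo a b, u c ≠ 0) : ∃ x ∈ Ioo a b, y x = 0 := by
  by_contra! hy0
  obtain ⟨c, hc, huc0⟩ := hu0
  have huc : ContinuousOn u (Icc a b) := fun x hx => (hu x hx).continuousAt.continuousWithinAt
  obtain ⟨α, hα, β, hβ, hαβ, huα, huβ, hne⟩ := exists_consecutive_zeros huc ha hb hc huc0
  have hIcc : Icc α β ⊆ Icc a b := Icc_subset_Icc hα.1 hβ.2
  have hIoo : Ioo α β ⊆ Ioo a b := Ioo_subset_Ioo hα.1 hβ.2
  have not_pos {v v' : ℝ → ℝ} (hv : IsSolution Q v v') : ¬∀ x ∈ Ioo α β, 0 < u x * v x :=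
    not_forall_mul_pos hv (fun x hx => hu x (hIcc hx)) (hu'c.mono hIcc)
      (fun x hx => hu' x (hIoo hx)) (fun x hx => hq x (hIoo hx)) hαβ huα huβ
  have huy_cont : ContinuousOn (fun x => u x * y x) (Ioo α β) :=
    (huc.mono (Ioo_subset_Icc_self.trans hIcc)).mul hy.continuous.continuousOn
  rcases pos_or_neg_of_ne_zero huy_cont fun x hx => mul_ne_zero (hne x hx) (hy0 x (hIoo hx))
    with hpos | hneg
  · exact not_pos hy hpos
  · exact not_pos hy.neg fun x hx => by simpa only [mul_neg, neg_pos] using hneg x hx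

end SturmComparison

section GlobalExistence

variable {F : Type*} [NormedAddCommGroup F] [NormedSpace ℝ F] {v : ℝ → F → F} {t₀ : ℝ}

lemma exists_isIntegralCurve_of_eqOn {γ : ℕ → ℝ → F}
    (hγ : ∀ N : ℕ, ∀ t ∈ Metric.ball t₀ (N + 1), HasDerivAt (γ N) (v t (γ N t)) t)
    (agree : ∀ N M : ℕ, N ≤ M → EqOn (γ N) (γ M) (Metric.ball t₀ (N + 1))) :
    ∃ Γ : ℝ → F, Γ t₀ = γ 0 t₀ ∧ IsIntegralCurve Γ v := by
  have mem_ball (t : ℝ) : t ∈ Metric.ball t₀ (⌊dist t t₀⌋₊ + 1) :=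
    Metric.mem_ball.2 <| Nat.lt_floor_add_one _
  refine ⟨fun t => γ ⌊dist t t₀⌋₊ t, by simp, fun t => ?_⟩
  refine (hγ _ t (mem_ball t)).congr_of_eventuallyEq ?_
  filter_upwards [Metric.isOpen_ball.mem_nhds (mem_ball t)] with s hs
  rcases le_total ⌊dist s t₀⌋₊ ⌊dist t t₀⌋₊ with h | h
  · exact agree _ _ h (mem_ball s)
  · exact (agree _ _ h hs).symm

variable [CompleteSpace F]

lemma exists_isIntegralCurve (hcont : ∀ x, Continuous fun t => v t x)
    (hlip : ∀ T, ∃ K, ∀ t ∈ Metric.closedBall t₀ T, LipschitzWith K (v t))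
    (hbdd : ∀ T, ∃ L : ℝ≥0, ∀ t ∈ Metric.closedBall t₀ T, ∀ x, ‖v t x‖ ≤ L) (x₀ : F) :
    ∃ γ : ℝ → F, γ t₀ = x₀ ∧ IsIntegralCurve γ v := by
  choose K hK using hlip
  choose L hL using hbdd
  have local_solution : ∀ N : ℕ, ∃ γ : ℝ → F, γ t₀ = x₀ ∧
      ∀ t ∈ Metric.ball t₀ (N + 1), HasDerivAt γ (v t (γ t)) t := by
    intro N
    have hpos : (0 : ℝ) ≤ N + 1 := by positivity
    simp only [Real.closedBall_eq_Icc] at hK hL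
    have picard : IsPicardLindelof v (tmin := t₀ - (N + 1)) (tmax := t₀ + (N + 1))
        ⟨t₀, by constructor <;> linarith [hpos]⟩
        x₀ (L (N + 1) * (N + 1)) 0 (L (N + 1)) (K (N + 1)) :=
      { lipschitzOnWith := fun t ht => (hK _ t ht).lipschitzOnWith
        continuousOn := fun x _ => (hcont x).continuousOn
        norm_le := fun t ht x _ => hL _ t ht x
        mul_max_le := by simp }
    obtain ⟨γ, hγ0, hγ⟩ := picard.exists_eq_forall_mem_Icc_hasDerivWithinAt₀
    refine ⟨γ, hγ0, fun t ht => ?_⟩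
    rw [Real.ball_eq_Ioo] at ht
    exact (hγ t (Ioo_subset_Icc_self ht)).hasDerivAt (Icc_mem_nhds ht.1 ht.2)
  choose γ hγ0 hγ using local_solution
  obtain ⟨Γ, hΓ0, hΓ⟩ := exists_isIntegralCurve_of_eqOn hγ fun N M hNM => by
    have hball : Metric.ball t₀ (N + 1 : ℝ) ⊆ Metric.ball t₀ (M + 1) :=
      Metric.ball_subset_ball (by gcongr)
    have ht₀ : t₀ ∈ Metric.ball t₀ (N + 1 : ℝ) := Metric.mem_ball_self (by positivity)
    have hlip := fun t (ht : t ∈ Metric.ball t₀ (N + 1 : ℝ)) =>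
      (hK _ t (Metric.ball_subset_closedBall ht)).lipschitzOnWith (s := univ)
    have hN := hγ N
    have hM := fun t ht => hγ M t (hball ht)
    rw [Real.ball_eq_Ioo] at ht₀ hlip hN hM ⊢
    exact ODE_solution_unique_of_mem_Ioo hlip ht₀ (fun t ht => ⟨hN t ht, trivial⟩)
      (fun t ht => ⟨hM t ht, trivial⟩) (by rw [hγ0, hγ0])
  exact ⟨Γ, hΓ0.trans (hγ0 0), hΓ⟩

end GlobalExistence

section PruferAngle

/-- `θ` is a Prüfer angle for `y'' = -Q y`: the angle of polar coordinates `y = r sin θ`,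
`y' = r cos θ` of a nonzero solution. -/
def IsPruferAngle (Q θ : ℝ → ℝ) : Prop :=
  ∀ x, HasDerivAt θ (cos (θ x) ^ 2 + Q x * sin (θ x) ^ 2) x

variable {Q θ : ℝ → ℝ}

lemma sin_sq_sub_sin_sq (a b : ℝ) : sin a ^ 2 - sin b ^ 2 = sin (a - b) * sin (a + b) := by
  rw [sin_sub, sin_add]
  linear_combination sin b ^ 2 * sin_sq_add_cos_sq a - sin a ^ 2 * sin_sq_add_cos_sq b

lemma pruferField_sub (q a b : ℝ) :
    (cos a ^ 2 + q * sin a ^ 2) - (cos b ^ 2 + q * sin b ^ 2)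
      = (q - 1) * (sin (a - b) * sin (a + b)) := by
  rw [← sin_sq_sub_sin_sq, cos_sq', cos_sq']
  ring

lemma lipschitzWith_pruferField {q : ℝ} {M : ℝ≥0} (hq : |q| ≤ M) :
    LipschitzWith (M + 1) fun a : ℝ => cos a ^ 2 + q * sin a ^ 2 := by
  refine LipschitzWith.of_dist_le_mul fun a b => ?_
  rw [Real.dist_eq, Real.dist_eq, pruferField_sub, abs_mul, abs_mul, NNReal.coe_add, NNReal.coe_one]
  have hq1 : |q - 1| ≤ M + 1 := (abs_sub q 1).trans (by simpa using hq)
  have hsin : |sin (a - b)| * |sin (a + b)| ≤ |a - b| :=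
    (mul_le_of_le_one_right (abs_nonneg _) (abs_sin_le_one _)).trans abs_sin_le_abs
  gcongr

lemma abs_pruferField_le {q : ℝ} {M : ℝ≥0} (hq : |q| ≤ M) (a : ℝ) :
    |cos a ^ 2 + q * sin a ^ 2| ≤ M + 1 := by
  have h1 := sin_sq_add_cos_sq a
  have h2 := abs_le.1 hq
  rw [abs_le]
  constructor <;> nlinarith [sq_nonneg (sin a), sq_nonneg (cos a)]

lemma exists_isPruferAngle (hQ : Continuous Q) (x₀ α : ℝ) :
    ∃ θ : ℝ → ℝ, θ x₀ = α ∧ IsPruferAngle Q θ := by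
  have bound : ∀ T, ∃ M : ℝ≥0, ∀ x ∈ Metric.closedBall x₀ T, |Q x| ≤ M := fun T => by
    obtain ⟨C, hC⟩ := (isCompact_closedBall x₀ T).exists_bound_of_continuousOn hQ.continuousOn
    exact ⟨C.toNNReal, fun x hx => (hC x hx).trans (le_coe_toNNReal C)⟩
  choose M hM using bound
  exact exists_isIntegralCurve (v := fun x a => cos a ^ 2 + Q x * sin a ^ 2)
    (fun a => by fun_prop) (fun T => ⟨M T + 1, fun x hx => lipschitzWith_pruferField (hM T x hx)⟩)
    (fun T => ⟨M T + 1, fun x hx => abs_pruferField_le (hM T x hx)⟩) α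

lemma IsPruferAngle.continuous (hθ : IsPruferAngle Q θ) : Continuous θ :=
  continuous_iff_continuousAt.2 fun x => (hθ x).continuousAt

lemma IsPruferAngle.const_sub_comp_const_sub (hθ : IsPruferAngle Q θ) (k : ℤ) (c : ℝ) :
    IsPruferAngle (fun x => Q (c - x)) fun x => k * π - θ (c - x) := fun x => by
  refine (((hθ (c - x)).comp_const_sub c x).const_sub (k * π)).congr_deriv ?_
  have hsign : (((-1 : ℝ) ^ k)) ^ 2 = 1 := by
    rw [← zpow_natCast, zpow_comm]; simp
  rw [sin_int_mul_pi_sub, cos_int_mul_pi_sub]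
  linear_combination (-(cos (θ (c - x)) ^ 2 + Q (c - x) * sin (θ (c - x)) ^ 2)) * hsign

end PruferAngle

section PruferComparison

variable {Q₁ Q₂ θ₁ θ₂ Q θ : ℝ → ℝ} {a b : ℝ}

lemma monotoneOn_mul_exp_neg_integral {A B D : ℝ → ℝ} (hA : Continuous A)
    (hD : ∀ x ∈ Icc a b, HasDerivAt D (A x * D x + B x) x) (hB : ∀ x ∈ Icc a b, 0 ≤ B x) :
    MonotoneOn (fun x => D x * exp (-∫ t in a..x, A t)) (Icc a b) := by
  have hd : ∀ x ∈ Icc a b, HasDerivAt (fun x => D x * exp (-∫ t in a..x, A t))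
      (B x * exp (-∫ t in a..x, A t)) x := fun x hx =>
    ((hD x hx).mul (hA.integral_hasStrictDerivAt a x).hasDerivAt.neg.exp).congr_deriv (by
      simp only [Pi.neg_apply]
      ring)
  refine monotoneOn_of_deriv_nonneg (convex_Icc a b)
    (fun x hx => (hd x hx).continuousAt.continuousWithinAt)
    (fun x hx => (hd x (interior_subset hx)).differentiableAt.differentiableWithinAt)
    fun x hx => ?_
  rw [(hd x (interior_subset hx)).deriv]
  exact mul_nonneg (hB x (interior_subset hx)) (exp_pos _).le

lemma sinc_mul_self (x : ℝ) : sinc x * x = sin x := by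
  rcases eq_or_ne x 0 with rfl | hx
  · simp
  · rw [sinc_of_ne_zero hx, div_mul_cancel₀ _ hx]

lemma IsPruferAngle.exists_monotoneOn_sub_mul (h₁ : IsPruferAngle Q₁ θ₁)
    (h₂ : IsPruferAngle Q₂ θ₂) (hQ₁ : Continuous Q₁) (hQ : ∀ x ∈ Icc a b, Q₁ x ≤ Q₂ x) :
    ∃ w : ℝ → ℝ, (∀ x, 0 < w x) ∧ MonotoneOn (fun x => (θ₂ x - θ₁ x) * w x) (Icc a b) := by
  have hθ₁ := h₁.continuous
  have hθ₂ := h₂.continuous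
  refine ⟨fun x => exp (-∫ t in a..x, (Q₁ t - 1) * (sinc (θ₂ t - θ₁ t) * sin (θ₂ t + θ₁ t))),
    fun x => exp_pos _, monotoneOn_mul_exp_neg_integral
      (B := fun x => (Q₂ x - Q₁ x) * sin (θ₂ x) ^ 2) (by fun_prop)
      (fun x _ => ((h₂ x).sub (h₁ x)).congr_deriv ?_)
      fun x hx => mul_nonneg (sub_nonneg.2 (hQ x hx)) (sq_nonneg _)⟩
  linear_combination pruferField_sub (Q₁ x) (θ₂ x) (θ₁ x)
    - (Q₁ x - 1) * sin (θ₂ x + θ₁ x) * sinc_mul_self (θ₂ x - θ₁ x)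

lemma IsPruferAngle.le_of_le (h₁ : IsPruferAngle Q₁ θ₁) (h₂ : IsPruferAngle Q₂ θ₂)
    (hQ₁ : Continuous Q₁) (hab : a ≤ b) (hQ : ∀ x ∈ Icc a b, Q₁ x ≤ Q₂ x)
    (ha : θ₁ a ≤ θ₂ a) : θ₁ b ≤ θ₂ b := by
  obtain ⟨w, hw, hmono⟩ := h₁.exists_monotoneOn_sub_mul h₂ hQ₁ hQ
  have hb : 0 ≤ (θ₂ b - θ₁ b) * w b :=
    (mul_nonneg (sub_nonneg.2 ha) (hw a).le).trans
      (hmono (left_mem_Icc.2 hab) (right_mem_Icc.2 hab) hab)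
  exact sub_nonneg.1 (nonneg_of_mul_nonneg_left hb (hw b))

lemma IsPruferAngle.exists_sin_ne_zero (hθ : IsPruferAngle Q θ) (hab : a < b) :
    ∃ x ∈ Ioo a b, sin (θ x) ≠ 0 := by
  by_contra! hsin
  obtain ⟨x, hx⟩ := exists_between hab
  have hconst : (fun y => sin (θ y)) =ᶠ[𝓝 x] fun _ => 0 := by
    filter_upwards [Ioo_mem_nhds hx.1 hx.2] with y hy using hsin y hy
  have hderiv := (hθ x).sin.unique ((hasDerivAt_const x (0 : ℝ)).congr_of_eventuallyEq hconst)
  have hcos := cos_sq' (θ x)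
  simp only [hsin x hx] at hderiv hcos
  have : cos (θ x) = 0 := by simpa [hcos] using hderiv
  simp [this] at hcos

lemma IsPruferAngle.lt_of_le (h₁ : IsPruferAngle Q₁ θ₁) (h₂ : IsPruferAngle Q₂ θ₂)
    (hQ₁ : Continuous Q₁) (hab : a < b) (hQ : ∀ x ∈ Icc a b, Q₁ x < Q₂ x)
    (ha : θ₁ a ≤ θ₂ a) : θ₁ b < θ₂ b := by
  have hle : ∀ x ∈ Icc a b, Q₁ x ≤ Q₂ x := fun x hx => (hQ x hx).le
  refine lt_of_le_of_ne (h₁.le_of_le h₂ hQ₁ hab.le hle ha) fun hb => ?_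
  obtain ⟨w, hw, hmono⟩ := h₁.exists_monotoneOn_sub_mul h₂ hQ₁ hle
  have angles_eq : ∀ x ∈ Icc a b, θ₂ x - θ₁ x = 0 := by
    intro x hx
    have hax := hmono (left_mem_Icc.2 hab.le) hx hx.1
    have hxb := hmono hx (right_mem_Icc.2 hab.le) hx.2
    simp only [hb, sub_self, zero_mul] at hxb
    have := le_antisymm hxb ((mul_nonneg (sub_nonneg.2 ha) (hw a).le).trans hax)
    exact (mul_eq_zero.1 this).resolve_right (hw x).ne'
  obtain ⟨x, hx, hsin⟩ := h₁.exists_sin_ne_zero hab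
  have hxI := Ioo_subset_Icc_self hx
  have hderiv : (cos (θ₂ x) ^ 2 + Q₂ x * sin (θ₂ x) ^ 2)
      - (cos (θ₁ x) ^ 2 + Q₁ x * sin (θ₁ x) ^ 2) ≤ 0 :=
    deriv_nonpos_of_forall_le_left ((h₂ x).sub (h₁ x)) hx.1 fun y hy =>
      ((angles_eq x hxI).trans (angles_eq y ⟨hy.1.le, hy.2.le.trans hxI.2⟩).symm).le
  rw [sub_eq_zero.1 (angles_eq x hxI)] at hderiv
  have := mul_pos (sub_pos.2 (hQ x hxI)) (pow_pos (abs_pos.2 hsin) 2)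
  rw [sq_abs] at this
  linarith

lemma IsPruferAngle.abs_sub_le (h₁ : IsPruferAngle Q₁ θ₁) (h₂ : IsPruferAngle Q₂ θ₂)
    (hab : a ≤ b) (ha : θ₁ a = θ₂ a) {M : ℝ≥0} (hM : ∀ x ∈ Icc a b, |Q₁ x| ≤ M) {ε : ℝ}
    (hε : ∀ x ∈ Icc a b, |Q₂ x - Q₁ x| ≤ ε) :
    |θ₂ b - θ₁ b| ≤ gronwallBound 0 (M + 1) ε (b - a) := by
  have h := dist_le_of_approx_trajectories_ODE_of_mem (s := fun _ => univ)
    (v := fun x a => cos a ^ 2 + Q₁ x * sin a ^ 2) (K := M + 1) (εf := ε) (εg := 0) (δ := 0)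
    (fun x hx => (lipschitzWith_pruferField (hM x (Ico_subset_Icc_self hx))).lipschitzOnWith)
    h₂.continuous.continuousOn (fun x _ => (h₂ x).hasDerivWithinAt)
    (fun x hx => ?_) (fun _ _ => trivial)
    h₁.continuous.continuousOn (fun x _ => (h₁ x).hasDerivWithinAt)
    (fun x _ => (dist_self _).le) (fun _ _ => trivial) (by rw [ha, dist_self])
    b (right_mem_Icc.2 hab)
  · rwa [add_zero, Real.dist_eq, NNReal.coe_add, NNReal.coe_one] at h
  · have hfield : cos (θ₂ x) ^ 2 + Q₂ x * sin (θ₂ x) ^ 2 - (cos (θ₂ x) ^ 2 + Q₁ x * sin (θ₂ x) ^ 2)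
        = (Q₂ x - Q₁ x) * sin (θ₂ x) ^ 2 := by ring
    rw [Real.dist_eq, hfield, abs_mul, abs_of_nonneg (sq_nonneg (sin (θ₂ x)))]
    exact (mul_le_of_le_one_right (abs_nonneg _) (sin_sq_le_one _)).trans
      (hε x (Ico_subset_Icc_self hx))

/-- A Prüfer angle crosses multiples of `π` only upwards: there `θ' = 1`. -/
lemma IsPruferAngle.int_mul_pi_lt (hθ : IsPruferAngle Q θ) {k : ℤ} (hab : a < b)
    (ha : k * π ≤ θ a) : k * π < θ b := by
  have deriv_at_multiple {x : ℝ} (hx : θ x = k * π) :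
      cos (θ x) ^ 2 + Q x * sin (θ x) ^ 2 = 1 := by
    rw [cos_sq', hx, sin_int_mul_pi]
    ring
  have hle : ∀ x ∈ Icc a b, k * π ≤ θ x := fun x hx =>
    image_le_of_deriv_right_lt_deriv_boundary continuousOn_const
      (fun x _ => hasDerivWithinAt_const x _ _) ha hθ
      (fun x _ hx => by rw [deriv_at_multiple hx.symm]; exact one_pos) hx
  refine lt_of_le_of_ne (hle b (right_mem_Icc.2 hab.le)) fun hb => ?_
  have := deriv_nonpos_of_forall_le_left (hθ b) hab fun x hx =>
    hb ▸ hle x (Ioo_subset_Icc_self hx)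
  rw [deriv_at_multiple hb.symm] at this
  exact absurd this (by norm_num)

lemma IsPruferAngle.add_comp_neg (hθ : IsPruferAngle Q θ) (hQ : Continuous Q)
    (heven : Q.Even) {k : ℤ} (h0 : θ 0 = k * π / 2) (ha : 0 ≤ a) :
    θ a + θ (-a) = k * π := by
  have hreflect := hθ.const_sub_comp_const_sub k 0
  simp only [zero_sub, show ∀ x, Q (-x) = Q x from heven] at hreflect
  have h0' : θ 0 = k * π - θ (-0) := by
    rw [neg_zero]
    linarith
  rw [← eq_sub_iff_add_eq]
  exact (hθ.le_of_le hreflect hQ ha (fun x _ => le_rfl) h0'.le).antisymm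
    (hreflect.le_of_le hθ hQ ha (fun x _ => le_rfl) h0'.ge)

end PruferComparison

section PruferSolutions

variable {Q θ y y' : ℝ → ℝ}

lemma IsPruferAngle.exists_isSolution (hθ : IsPruferAngle Q θ) (hQ : Continuous Q) :
    ∃ r : ℝ → ℝ, (∀ x, 0 < r x) ∧
      IsSolution Q (fun x => r x * sin (θ x)) (fun x => r x * cos (θ x)) := by
  have hθc := hθ.continuous
  set g : ℝ → ℝ := fun x => (1 - Q x) * (sin (θ x) * cos (θ x))
  have hgc : Continuous g := by fun_prop
  refine ⟨fun x => exp (∫ t in (0 : ℝ)..x, g t), fun x => exp_pos _, fun x => ?_⟩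
  have hr := (hgc.integral_hasStrictDerivAt 0 x).hasDerivAt.exp
  have hsc := sin_sq_add_cos_sq (θ x)
  constructor
  · refine (hr.mul (hθ x).sin).congr_deriv ?_
    linear_combination (exp (∫ t in (0 : ℝ)..x, g t) * cos (θ x)) * hsc
  · refine (hr.mul (hθ x).cos).congr_deriv ?_
    linear_combination (-exp (∫ t in (0 : ℝ)..x, g t) * Q x * sin (θ x)) * hsc

lemma IsPruferAngle.deriv_mul_sin_eq (hθ : IsPruferAngle Q θ) (hQ : Continuous Q)
    (hy : IsSolution Q y y') {x₀ : ℝ} (h₀ : y' x₀ * sin (θ x₀) = y x₀ * cos (θ x₀)) (x : ℝ) :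
    y' x * sin (θ x) = y x * cos (θ x) := by
  obtain ⟨r, hr, hsol⟩ := hθ.exists_isSolution hQ
  have hW := hy.wronskian_eq hsol x x₀
  have : r x * (y' x * sin (θ x) - y x * cos (θ x)) = 0 := by
    linear_combination hW + r x₀ * h₀
  exact sub_eq_zero.1 ((mul_eq_zero.1 this).resolve_left (hr x).ne')

lemma IsSolution.eq_zero (hy : IsSolution Q y y') (hQ : Continuous Q) {x₀ : ℝ} (h₀ : y x₀ = 0)
    (h₀' : y' x₀ = 0) (x : ℝ) : y x = 0 := by
  obtain ⟨θ, hθx, hθ⟩ := exists_isPruferAngle hQ x 0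
  have := hθ.deriv_mul_sin_eq hQ hy (x₀ := x₀) (by rw [h₀, h₀', zero_mul, zero_mul]) x
  simpa [hθx] using this.symm

end PruferSolutions

section ZeroCounting

variable {Q q θ u u' : ℝ → ℝ} {a b : ℝ}

lemma IsPruferAngle.floor_le_floor (hθ : IsPruferAngle Q θ) (hab : a ≤ b) :
    ⌊θ a / π⌋ ≤ ⌊θ b / π⌋ := by
  rcases hab.eq_or_lt with rfl | hab
  · rfl
  · rw [Int.le_floor, le_div_iff₀ pi_pos]
    exact (hθ.int_mul_pi_lt hab ((le_div_iff₀ pi_pos).1 (Int.floor_le _))).le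

lemma IsPruferAngle.floor_lt_floor (hθ : IsPruferAngle Q θ) {x : ℝ} (hx : x ∈ Ioo a b)
    (hsin : sin (θ x) = 0) : ⌊θ a / π⌋ < ⌊θ b / π⌋ := by
  obtain ⟨k, hk⟩ := sin_eq_zero_iff.1 hsin
  have hak : ⌊θ a / π⌋ * π < k * π :=
    hk ▸ hθ.int_mul_pi_lt hx.1 ((le_div_iff₀ pi_pos).1 (Int.floor_le _))
  have hkb : k ≤ ⌊θ b / π⌋ := by
    rw [Int.le_floor, le_div_iff₀ pi_pos]
    exact (hθ.int_mul_pi_lt hx.2 hk.le).le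
  exact (Int.cast_lt.1 (lt_of_mul_lt_mul_right hak pi_pos.le)).trans_le hkb

/-- By Sturm's comparison theorem, distinct zeros of a solution of a less oscillating equation are
separated by a multiple of `π` in the Prüfer angle. -/
lemma IsPruferAngle.card_zeros_le (hθ : IsPruferAngle Q θ) (hQ : Continuous Q)
    (hab : a ≤ b) (hu : ∀ x ∈ Icc a b, HasDerivAt u (u' x) x) (hu'c : ContinuousOn u' (Icc a b))
    (hu' : ∀ x ∈ Ioo a b, HasDerivAt u' (-q x * u x) x) (hq : ∀ x ∈ Ioo a b, q x < Q x)
    (hne : ∀ x ∈ Icc a b, ∀ y ∈ Icc a b, x < y → ∃ c ∈ Ioo x y, u c ≠ 0) {S : Finset ℝ}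
    (hS : ∀ x ∈ S, x ∈ Icc a b ∧ u x = 0) : (S.card : ℤ) ≤ ⌊θ b / π⌋ + 1 - ⌊θ a / π⌋ := by
  obtain ⟨r, hr, hsol⟩ := hθ.exists_isSolution hQ
  have floor_strictMonoOn : StrictMonoOn (fun x => ⌊θ x / π⌋) S := by
    intro x hx y hy hxy
    have hI : Icc x y ⊆ Icc a b := Icc_subset_Icc (hS x hx).1.1 (hS y hy).1.2
    have hI' : Ioo x y ⊆ Ioo a b := Ioo_subset_Ioo (hS x hx).1.1 (hS y hy).1.2
    obtain ⟨z, hz, hz0⟩ := sturm_comparison hsol (fun t ht => hu t (hI ht)) (hu'c.mono hI)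
      (fun t ht => hu' t (hI' ht)) (fun t ht => hq t (hI' ht)) (hS x hx).2 (hS y hy).2
      (hne x (hS x hx).1 y (hS y hy).1 hxy)
    exact hθ.floor_lt_floor hz ((mul_eq_zero.1 hz0).resolve_left (hr z).ne')
  have hcard : S.card ≤ (Finset.Icc ⌊θ a / π⌋ ⌊θ b / π⌋).card :=
    Finset.card_le_card_of_injOn _ (fun x hx => Finset.mem_coe.2 <| Finset.mem_Icc.2
      ⟨hθ.floor_le_floor (hS x hx).1.1, hθ.floor_le_floor (hS x hx).1.2⟩) floor_strictMonoOn.injOn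
  have hfloor := hθ.floor_le_floor hab
  rw [Int.card_Icc] at hcard
  omega

end ZeroCounting

section Boundary

variable {Q θ y y' z z' : ℝ → ℝ} {c T : ℝ}

lemma IsSolution.unique (hy : IsSolution Q y y') (hz : IsSolution Q z z') (hQ : Continuous Q)
    {x₀ : ℝ} (h₀ : y x₀ = z x₀) (h₀' : y' x₀ = z' x₀) (x : ℝ) : y x = z x := by
  have hsub : IsSolution Q (fun x => y x - z x) (fun x => y' x - z' x) := fun x =>
    ⟨(hy x).1.sub (hz x).1, ((hy x).2.sub (hz x).2).congr_deriv (by ring)⟩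
  exact sub_eq_zero.1 (hsub.eq_zero hQ (sub_eq_zero.2 h₀) (sub_eq_zero.2 h₀') x)

lemma IsSolution.deriv_eq_zero_iff_symm (hy : IsSolution Q y y') (hQ : Continuous Q)
    (hsymm : ∀ x, Q (2 * c - x) = Q x) : y' c = 0 ↔ ∀ x, y (2 * c - x) = y x := by
  have hreflect := hy.comp_const_sub (2 * c)
  simp only [hsymm] at hreflect
  have hc : 2 * c - c = c := by ring
  constructor
  · intro h
    exact hreflect.unique hy hQ (x₀ := c) (by rw [hc]) (by rw [hc, h, neg_zero])
  · intro h
    have hderiv := (hreflect c).1.unique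
      ((hy c).1.congr_of_eventuallyEq (Eventually.of_forall h))
    simp only [hc] at hderiv
    linarith

lemma IsSolution.eq_zero_iff_antisymm (hy : IsSolution Q y y') (hQ : Continuous Q)
    (hsymm : ∀ x, Q (2 * c - x) = Q x) : y c = 0 ↔ ∀ x, y (2 * c - x) = -y x := by
  have hreflect := hy.comp_const_sub (2 * c)
  simp only [hsymm] at hreflect
  have hc : 2 * c - c = c := by ring
  constructor
  · intro h
    exact hreflect.unique hy.neg hQ (x₀ := c) (by rw [hc, h, neg_zero]) (by rw [hc])
  · intro h
    have hval := h c
    rw [hc] at hval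
    linarith

lemma even_and_periodic_iff {f : ℝ → ℝ} : f.Even ∧ f.Periodic (2 * T) ↔
    (∀ x, f (2 * 0 - x) = f x) ∧ ∀ x, f (2 * T - x) = f x := by
  simp only [mul_zero, zero_sub]
  refine and_congr_right fun heven => ⟨fun hper x => ?_, fun hsymm x => ?_⟩
  · rw [sub_eq_neg_add, hper, heven]
  · rw [← heven x, ← hsymm (-x)]
    ring_nf

lemma odd_and_periodic_iff {f : ℝ → ℝ} : f.Odd ∧ f.Periodic (2 * T) ↔
    (∀ x, f (2 * 0 - x) = -f x) ∧ ∀ x, f (2 * T - x) = -f x := by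
  simp only [mul_zero, zero_sub]
  refine and_congr_right fun hodd => ⟨fun hper x => ?_, fun hsymm x => ?_⟩
  · rw [sub_eq_neg_add, hper, hodd]
  · rw [← neg_neg (f x), ← hodd x, ← hsymm (-x)]
    ring_nf

lemma IsSolution.even_and_periodic_iff (hy : IsSolution Q y y') (hQ : Continuous Q)
    (heven : Q.Even) (hper : Q.Periodic (2 * T)) :
    y.Even ∧ y.Periodic (2 * T) ↔ y' 0 = 0 ∧ y' T = 0 := by
  have hsymm := SturmLiouville.even_and_periodic_iff.1 ⟨heven, hper⟩
  rw [hy.deriv_eq_zero_iff_symm hQ hsymm.1, hy.deriv_eq_zero_iff_symm hQ hsymm.2,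
    SturmLiouville.even_and_periodic_iff]

lemma IsSolution.odd_and_periodic_iff (hy : IsSolution Q y y') (hQ : Continuous Q)
    (heven : Q.Even) (hper : Q.Periodic (2 * T)) :
    y.Odd ∧ y.Periodic (2 * T) ↔ y 0 = 0 ∧ y T = 0 := by
  have hsymm := SturmLiouville.even_and_periodic_iff.1 ⟨heven, hper⟩
  rw [hy.eq_zero_iff_antisymm hQ hsymm.1, hy.eq_zero_iff_antisymm hQ hsymm.2,
    SturmLiouville.odd_and_periodic_iff]

lemma IsPruferAngle.exists_boundary_solution_iff (hθ : IsPruferAngle Q θ) (hQ : Continuous Q)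
    {a b α : ℝ} (ha : θ a = α) :
    (∃ y y', IsSolution Q y y' ∧ y ≠ 0 ∧ y' a * sin α = y a * cos α ∧
      y' b * sin α = y b * cos α) ↔ sin (θ b - α) = 0 := by
  rw [sin_sub]
  constructor
  · rintro ⟨y, y', hy, hy0, hya, hyb⟩
    have hyθ := hθ.deriv_mul_sin_eq hQ hy (by rwa [ha]) b
    by_contra hne
    have hb : y b = 0 := (mul_eq_zero.1 (by linear_combination sin α * hyθ - sin (θ b) * hyb :
      y b * (sin (θ b) * cos α - cos (θ b) * sin α) = 0)).resolve_right hne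
    have hb' : y' b = 0 := (mul_eq_zero.1 (by linear_combination cos α * hyθ - cos (θ b) * hyb :
      y' b * (sin (θ b) * cos α - cos (θ b) * sin α) = 0)).resolve_right hne
    exact hy0 (funext (hy.eq_zero hQ hb hb'))
  · intro hsin
    obtain ⟨r, hr, hsol⟩ := hθ.exists_isSolution hQ
    refine ⟨_, _, hsol, fun h0 => ?_, by rw [ha]; ring, by linear_combination -r b * hsin⟩
    obtain ⟨x, -, hx⟩ := hθ.exists_sin_ne_zero one_pos
    exact (mul_ne_zero (hr x).ne' hx) (congrFun h0 x)

end Boundary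

section LadderPolynomials

open Polynomial

/-- The Gegenbauer equation of parameter `s` and degree `n`; `ε = 1` is the classical equation, and
`ε = -1` the one obtained from it by passing to the imaginary axis. -/
def GegenbauerEquation (ε : ℝ) (n : ℕ) (s : ℝ) (P : ℝ[X]) : Prop :=
  (1 - C ε * X ^ 2) * derivative (derivative P) - C (ε * (2 * s + 1)) * X * derivative P
    + C (ε * n * (n + 2 * s)) * P = 0

/-- Unnormalized Gegenbauer polynomials (`ε = 1`) and, up to factors of `i`, their values on the
imaginary axis (`ε = -1`), built by the raising operator. -/
noncomputable def ladderPoly (ε : ℝ) : ℕ → ℝ → ℝ[X]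
  | 0, _ => 1
  | n + 1, s => C (ε * (2 * s + 1)) * X * ladderPoly ε n (s + 1)
      - (1 - C ε * X ^ 2) * derivative (ladderPoly ε n (s + 1))

variable {ε s : ℝ} {n : ℕ}

lemma GegenbauerEquation.eval {P : ℝ[X]} (h : GegenbauerEquation ε n s P) (y : ℝ) :
    (1 - ε * y ^ 2) * (derivative (derivative P)).eval y
      - ε * (2 * s + 1) * y * (derivative P).eval y + ε * n * (n + 2 * s) * P.eval y = 0 := by
  simpa using congrArg (Polynomial.eval y) h

lemma GegenbauerEquation.derivative_ladderPoly_succ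
    (h : GegenbauerEquation ε n (s + 1) (ladderPoly ε n (s + 1))) :
    derivative (ladderPoly ε (n + 1) s)
      = C (ε * (n + 1) * (n + 2 * s + 1)) * ladderPoly ε n (s + 1) := by
  unfold GegenbauerEquation at h
  simp only [ladderPoly, derivative_sub, derivative_mul, derivative_C, derivative_X,
    derivative_one, derivative_X_pow] at h ⊢
  simp only [map_mul, map_add, map_one, map_ofNat, map_natCast] at h ⊢
  push_cast at h ⊢
  linear_combination -h

lemma gegenbauerEquation_ladderPoly (ε : ℝ) (n : ℕ) (s : ℝ) :
    GegenbauerEquation ε n s (ladderPoly ε n s) := by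
  induction n generalizing s with
  | zero => simp [GegenbauerEquation, ladderPoly]
  | succ n ih =>
    rw [GegenbauerEquation, (ih (s + 1)).derivative_ladderPoly_succ, derivative_C_mul, ladderPoly]
    push_cast
    simp only [map_mul, map_add, map_one, map_ofNat, map_natCast]
    ring

lemma derivative_ladderPoly_succ (ε : ℝ) (n : ℕ) (s : ℝ) :
    derivative (ladderPoly ε (n + 1) s)
      = C (ε * (n + 1) * (n + 2 * s + 1)) * ladderPoly ε n (s + 1) :=
  (gegenbauerEquation_ladderPoly ε n (s + 1)).derivative_ladderPoly_succ

lemma ladderPoly_one_ne_zero (n : ℕ) (hs : 0 ≤ s) : ladderPoly 1 n s ≠ 0 := by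
  induction n generalizing s with
  | zero => simp [ladderPoly]
  | succ n ih =>
    intro h0
    have hderiv := derivative_ladderPoly_succ 1 n s
    rw [h0, derivative_zero, eq_comm, mul_eq_zero, C_eq_zero] at hderiv
    exact hderiv.elim (by positivity) (ih (by positivity))

end LadderPolynomials

section PoschlTeller

open Polynomial

variable {Q θ : ℝ → ℝ} {s : ℝ}

lemma hasDerivAt_sin_rpow_mul_eval_cos (P : ℝ[X]) {r x : ℝ} (h : sin x ≠ 0 ∨ 1 ≤ r) :
    HasDerivAt (fun x => sin x ^ r * P.eval (cos x))
      (sin x ^ (r - 1) * (C r * X * P - (1 - X ^ 2) * derivative P).eval (cos x)) x := by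
  refine (((hasDerivAt_sin x).rpow_const h).mul
    ((P.hasDerivAt (cos x)).comp x (hasDerivAt_cos x))).congr_deriv ?_
  have hpow : sin x ^ r * sin x = sin x ^ (r - 1) * sin x ^ 2 := by
    rcases eq_or_ne (sin x) 0 with h0 | h0
    · simp [h0]
    · rw [rpow_sub_one h0]
      field_simp
  simp only [eval_sub, eval_mul, eval_C, eval_X, eval_one, eval_pow, Function.comp_apply,
    ← sin_sq x]
  linear_combination -(derivative P).eval (cos x) * hpow

lemma hasDerivAt_poschlTeller {n : ℕ} {P : ℝ[X]} (hP : GegenbauerEquation 1 n s P) {x : ℝ}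
    (hx : sin x ≠ 0) :
    HasDerivAt (fun x => sin x ^ (s - 1) * (C s * X * P - (1 - X ^ 2) * derivative P).eval (cos x))
      (-(s + n * (n + 2 * s) - s * (s - 1) * (cos x / sin x) ^ 2)
        * (sin x ^ s * P.eval (cos x))) x := by
  refine (hasDerivAt_sin_rpow_mul_eval_cos _ (Or.inl hx)).congr_deriv ?_
  have ode := hP.eval (cos x)
  have hcot : cos x / sin x * sin x = cos x := div_mul_cancel₀ _ hx
  have hsin := sin_sq x
  have hpow : sin x ^ s = sin x ^ (s - 1 - 1) * sin x ^ 2 := by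
    rw [rpow_sub_one hx, rpow_sub_one hx]
    field_simp
  simp only [eval_sub, eval_add, eval_mul, eval_C, eval_X, eval_one, eval_pow, derivative_sub,
    derivative_mul, derivative_C, derivative_X, derivative_one, derivative_X_pow,
    eval_zero, hpow, Nat.cast_ofNat, map_ofNat, eval_ofNat]
  generalize cos x / sin x = t at hcot ⊢
  generalize sin x ^ (s - 1 - 1) = T
  linear_combination T * (1 - cos x ^ 2) * ode
    - s * (s - 1) * T * P.eval (cos x) * (t * sin x + cos x) * hcot
    + (s + n * (n + 2 * s)) * T * P.eval (cos x) * hsin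

lemma exists_finset_zeros_sin_rpow_mul {S : Finset ℝ} {f : ℝ → ℝ}
    (hS : ∀ x ∈ S, x ∈ Ioo 0 π ∧ f x = 0) {r : ℝ} (hr : 0 < r) :
    ∃ T : Finset ℝ, T.card = S.card + 2 ∧ ∀ x ∈ T, x ∈ Icc 0 π ∧ sin x ^ r * f x = 0 := by
  have h0 : (0 : ℝ) ∉ insert π S := by
    simpa [pi_ne_zero.symm] using fun h => (hS 0 h).1.1.false
  have hπ : π ∉ S := fun h => (hS π h).1.2.false
  refine ⟨insert 0 (insert π S), by
    rw [Finset.card_insert_of_notMem h0, Finset.card_insert_of_notMem hπ], ?_⟩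
  simp only [Finset.forall_mem_insert]
  have hpow : (0 : ℝ) ^ r = 0 := zero_rpow hr.ne'
  exact ⟨⟨left_mem_Icc.2 pi_pos.le, by rw [sin_zero, hpow, zero_mul]⟩,
    ⟨right_mem_Icc.2 pi_pos.le, by rw [sin_pi, hpow, zero_mul]⟩,
    fun x hx => ⟨Ioo_subset_Icc_self (hS x hx).1, by rw [(hS x hx).2, mul_zero]⟩⟩

lemma exists_finset_zeros_ladderPoly_cos (n : ℕ) (hs : 0 ≤ s) :
    ∃ S : Finset ℝ, n ≤ S.card ∧ ∀ x ∈ S, x ∈ Ioo 0 π ∧ (ladderPoly 1 n s).eval (cos x) = 0 := by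
  induction n generalizing s with
  | zero => exact ⟨∅, le_rfl, by simp⟩
  | succ n ih =>
    obtain ⟨S, hcard, hS⟩ := ih (s := s + 1) (by positivity)
    obtain ⟨T, hTcard, hT⟩ :=
      exists_finset_zeros_sin_rpow_mul hS (r := 2 * s + 1) (by positivity)
    -- The derivative of `sin ^ (2 s + 1) * P_n^(s+1) (cos)` is `sin ^ (2 s) * P_{n+1}^(s) (cos)`.
    obtain ⟨U, hUcard, hU⟩ := exists_finset_deriv_eq_zero
      (fun x => hasDerivAt_sin_rpow_mul_eval_cos (ladderPoly 1 n (s + 1)) (x := x)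
        (Or.inr (by linarith))) T fun x hx => (hT x hx).2
    refine ⟨U, by omega, fun t ht => ?_⟩
    obtain ⟨hderiv, x, hx, y, hy, hxt, hty⟩ := hU t ht
    have htmem : t ∈ Ioo 0 π := ⟨(hT x hx).1.1.trans_lt hxt, hty.trans_le (hT y hy).1.2⟩
    refine ⟨htmem, ?_⟩
    simpa [ladderPoly, (rpow_pos_of_pos (sin_pos_of_mem_Ioo htmem) (2 * s)).ne'] using hderiv

lemma exists_eval_cos_ne_zero {P : ℝ[X]} (hP : P ≠ 0) {a b : ℝ} (ha : 0 ≤ a) (hb : b ≤ π)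
    (hab : a < b) : ∃ x ∈ Ioo a b, P.eval (cos x) ≠ 0 := by
  by_contra! hzero
  have hinj : InjOn cos (Ioo a b) :=
    injOn_cos.mono (Ioo_subset_Icc_self.trans (Icc_subset_Icc ha hb))
  refine hP (eq_zero_of_infinite_isRoot _ (((Ioo_infinite hab).image hinj).mono ?_))
  rintro _ ⟨x, hx, rfl⟩
  exact hzero x hx

theorem IsPruferAngle.succ_mul_pi_le_of_poschlTeller_lt (hθ : IsPruferAngle Q θ)
    (hQ : Continuous Q) (h0 : 0 ≤ θ 0) (hs : 1 < s) (n : ℕ)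
    (hlt : ∀ x ∈ Ioo 0 π, s + n * (n + 2 * s) - s * (s - 1) * (cos x / sin x) ^ 2 < Q x) :
    (n + 1) * π ≤ θ π := by
  have hs0 : 0 ≤ s := by linarith
  obtain ⟨S, hcard, hS⟩ := exists_finset_zeros_ladderPoly_cos n hs0
  obtain ⟨T, hTcard, hT⟩ := exists_finset_zeros_sin_rpow_mul hS (r := s) (by linarith)
  set P := ladderPoly 1 n s
  have hne : ∀ x ∈ Icc 0 π, ∀ y ∈ Icc 0 π, x < y →
      ∃ c ∈ Ioo x y, sin c ^ s * P.eval (cos c) ≠ 0 := fun x hx y hy hxy =>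
    have ⟨c, hc, hPc⟩ := exists_eval_cos_ne_zero (ladderPoly_one_ne_zero n hs0) hx.1 hy.2 hxy
    have hsin := sin_pos_of_pos_of_lt_pi (hx.1.trans_lt hc.1) (hc.2.trans_le hy.2)
    ⟨c, hc, mul_ne_zero (rpow_pos_of_pos hsin s).ne' hPc⟩
  have hcont : Continuous fun x =>
      sin x ^ (s - 1) * (C s * X * P - (1 - X ^ 2) * derivative P).eval (cos x) :=
    (continuous_sin.rpow_const fun _ => Or.inr (by linarith)).mul
      ((Polynomial.continuous _).comp continuous_cos)
  have key := hθ.card_zeros_le hQ pi_pos.le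
    (fun x _ => hasDerivAt_sin_rpow_mul_eval_cos P (Or.inr hs.le)) hcont.continuousOn
    (fun x hx => hasDerivAt_poschlTeller (gegenbauerEquation_ladderPoly 1 n s)
      (sin_pos_of_mem_Ioo hx).ne') hlt hne hT
  have hfloor : 0 ≤ ⌊θ 0 / π⌋ := Int.floor_nonneg.2 (by positivity)
  have hle : ((n + 1 : ℕ) : ℤ) ≤ ⌊θ π / π⌋ := by omega
  rw [Int.le_floor, le_div_iff₀ pi_pos] at hle
  exact_mod_cast hle

end PoschlTeller

section GaussianComparison

variable {Q θ : ℝ → ℝ} {a b k : ℝ}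

lemma isPruferAngle_gaussian (m : ℝ) :
    IsPruferAngle (fun x => -(m + (m * x) ^ 2)) (fun x => π / 2 - arctan (m * x)) := fun x => by
  refine (((hasDerivAt_id x).const_mul m).arctan.const_sub (π / 2)).congr_deriv ?_
  simp only [id_eq]
  rw [cos_pi_div_two_sub, sin_pi_div_two_sub, cos_sq_arctan, sin_sq, cos_sq_arctan]
  field_simp
  ring

/-- Comparison with the Gaussian centred at `b` whose logarithmic derivative at `a` is `-k`. -/
lemma IsPruferAngle.le_of_le_gaussian (hθ : IsPruferAngle Q θ) (hQ : Continuous Q) (hab : a < b)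
    (hk : 0 ≤ k) (hle : ∀ x ∈ Icc a b, Q x ≤ -(k / (b - a) + k ^ 2)) {n : ℤ}
    (ha : θ a ≤ n * π + π / 2 + arctan k) : θ b ≤ n * π + π / 2 := by
  have hba : 0 < b - a := sub_pos.2 hab
  have hm : k / (b - a) * (b - a) = k := div_mul_cancel₀ _ hba.ne'
  set m := k / (b - a)
  have hm0 : 0 ≤ m := by positivity
  have hgauss := (isPruferAngle_gaussian m).const_sub_comp_const_sub (n + 1) b
  have hcomp := hθ.le_of_le hgauss hQ hab.le (fun x hx => ?_) ?_
  · push_cast at hcomp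
    simp only [sub_self, mul_zero, arctan_zero] at hcomp
    linarith
  · have hmx : m * (b - x) ≤ k := hm ▸ mul_le_mul_of_nonneg_left (by linarith [hx.1]) hm0
    have hsq := pow_le_pow_left₀ (mul_nonneg hm0 (sub_nonneg.2 hx.2)) hmx 2
    linarith [hle x hx]
  · push_cast
    rw [hm]
    linarith

end GaussianComparison

section Tanh

lemma tanh_nonneg {x : ℝ} (hx : 0 ≤ x) : 0 ≤ tanh x := by
  rw [tanh_eq_sinh_div_cosh]
  exact div_nonneg (sinh_nonneg_iff.2 hx) (cosh_pos x).le

lemma hasDerivAt_tanh (x : ℝ) : HasDerivAt tanh (1 / cosh x ^ 2) x := by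
  refine (((hasDerivAt_sinh x).div (hasDerivAt_cosh x) (cosh_pos x).ne').congr_deriv ?_)
    |>.congr_of_eventuallyEq (.of_forall tanh_eq_sinh_div_cosh)
  rw [← cosh_sq_sub_sinh_sq x]
  ring

lemma strictMonoOn_sin_sub_tanh : StrictMonoOn (fun x => sin x - tanh x) (Icc 0 1) := by
  have hderiv x := (hasDerivAt_sin x).sub (hasDerivAt_tanh x)
  refine strictMonoOn_of_deriv_pos (convex_Icc 0 1)
    (fun x _ => (hderiv x).continuousAt.continuousWithinAt) fun x hx => ?_
  rw [interior_Icc] at hx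
  refine (hderiv x).deriv.symm ▸ sub_pos.2 ((div_lt_iff₀ (by positivity)).2 ?_)
  have hcosh : 1 + x ^ 2 ≤ cosh x ^ 2 := by
    rw [cosh_sq]
    nlinarith [hx.1, self_le_sinh_iff.2 hx.1.le]
  have hx2 : 0 < x ^ 2 := pow_pos hx.1 2
  have hx1 : x ^ 2 < 1 := by nlinarith [hx.1, hx.2]
  calc (1 : ℝ) < (1 - x ^ 2 / 2) * (1 + x ^ 2) := by nlinarith
    _ ≤ cos x * cosh x ^ 2 :=
      mul_le_mul (one_sub_sq_div_two_le_cos (x := x)) hcosh (by positivity)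
        ((by linarith : 0 ≤ 1 - x ^ 2 / 2).trans (one_sub_sq_div_two_le_cos (x := x)))

lemma tanh_le_sin {x : ℝ} (hx : x ∈ Icc (0 : ℝ) 1) : tanh x ≤ sin x := by
  simpa using strictMonoOn_sin_sub_tanh.monotoneOn (left_mem_Icc.2 zero_le_one) hx hx.1

lemma tanh_one_lt_sin_one : tanh 1 < sin 1 := by
  simpa using strictMonoOn_sin_sub_tanh (left_mem_Icc.2 zero_le_one)
    (right_mem_Icc.2 zero_le_one) one_pos

end Tanh

section ModifiedPoschlTeller

open Polynomial

variable {s c : ℝ} {n : ℕ} {Q θ φ : ℝ → ℝ}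

lemma hasDerivAt_cosh_rpow_mul_eval_sinh (P : ℝ[X]) (r x : ℝ) :
    HasDerivAt (fun x => cosh x ^ r * P.eval (sinh x))
      (cosh x ^ (r - 1) * (C r * X * P + (1 + X ^ 2) * derivative P).eval (sinh x)) x := by
  have hcosh := (cosh_pos x).ne'
  refine (((hasDerivAt_cosh x).rpow_const (Or.inl hcosh)).mul
    ((P.hasDerivAt (sinh x)).comp x (hasDerivAt_sinh x))).congr_deriv ?_
  have hpow : cosh x ^ r = cosh x ^ (r - 1) * cosh x := by
    rw [rpow_sub_one hcosh]
    field_simp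
  simp only [eval_add, eval_mul, eval_C, eval_X, eval_one, eval_pow, Function.comp_apply, hpow]
  linear_combination cosh x ^ (r - 1) * (derivative P).eval (sinh x) * cosh_sq x

lemma isSolution_modifiedPoschlTeller {P : ℝ[X]} (hP : GegenbauerEquation (-1) n (-s) P) :
    IsSolution (fun x => s + n * (2 * s - n) - s * (s + 1) * tanh x ^ 2)
      (fun x => cosh x ^ (-s) * P.eval (sinh x))
      (fun x => cosh x ^ (-s - 1) *
        (C (-s) * X * P + (1 + X ^ 2) * derivative P).eval (sinh x)) := fun x => by
  refine ⟨hasDerivAt_cosh_rpow_mul_eval_sinh P _ x,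
    (hasDerivAt_cosh_rpow_mul_eval_sinh _ _ x).congr_deriv ?_⟩
  have hcosh := (cosh_pos x).ne'
  have ode := hP.eval (sinh x)
  have htanh : tanh x * cosh x = sinh x := by rw [tanh_eq_sinh_div_cosh, div_mul_cancel₀ _ hcosh]
  have hpow : cosh x ^ (-s) = cosh x ^ (-s - 1 - 1) * cosh x ^ 2 := by
    rw [rpow_sub_one hcosh, rpow_sub_one hcosh]
    field_simp
  simp only [eval_add, eval_mul, eval_C, eval_X, eval_one, eval_pow, derivative_add,
    derivative_mul, derivative_C, derivative_X, derivative_one, derivative_X_pow, eval_zero, hpow,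
    Nat.cast_ofNat, map_ofNat, eval_ofNat]
  generalize cosh x ^ (-s - 1 - 1) = T
  linear_combination T * (1 + sinh x ^ 2) * ode
    - s * (s + 1) * T * P.eval (sinh x) * (tanh x * cosh x + sinh x) * htanh
    + (s + n * (2 * s - n)) * T * P.eval (sinh x) * cosh_sq x

lemma natDegree_ladderPoly_le (ε : ℝ) (n : ℕ) (s : ℝ) : (ladderPoly ε n s).natDegree ≤ n := by
  induction n generalizing s with
  | zero => simp [ladderPoly]
  | succ n ih =>
    have hderiv := congrArg natDegree (derivative_ladderPoly_succ ε n s)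
    rw [natDegree_derivative] at hderiv
    have := (natDegree_C_mul_le (ε * (n + 1) * (n + 2 * s + 1)) _).trans (ih (s + 1))
    omega

/-- The trigonometric factors select by parity: `P(0) = 0` for odd `n` and `P'(0) = 0` for even
`n`. -/
lemma eval_zero_ladderPoly_mul (ε : ℝ) (n : ℕ) (s : ℝ) :
    (ladderPoly ε n s).eval 0 * cos ((n + 1) * π / 2) = 0 ∧
      (derivative (ladderPoly ε n s)).eval 0 * sin ((n + 1) * π / 2) = 0 := by
  induction n generalizing s with
  | zero => simp [ladderPoly]
  | succ n ih =>
    obtain ⟨hval, hderiv⟩ := ih (s + 1)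
    have hangle : ((n + 1 : ℕ) + 1) * π / 2 = (n + 1) * π / 2 + π / 2 := by
      push_cast
      ring
    rw [hangle, cos_add_pi_div_two, sin_add_pi_div_two, derivative_ladderPoly_succ, eval_mul,
      eval_C, mul_assoc, hval, mul_zero, ladderPoly]
    simpa using hderiv

lemma eventually_ladderPoly_neg_bound (n : ℕ) {y : ℝ} (hy : 0 < y) :
    ∃ B : ℝ, ∀ᶠ s in atTop, 0 < (ladderPoly (-1) n (-s)).eval y ∧
      0 ≤ (derivative (ladderPoly (-1) n (-s))).eval y ∧
      (derivative (ladderPoly (-1) n (-s))).eval y ≤ B * (ladderPoly (-1) n (-s)).eval y := by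
  induction n with
  | zero => exact ⟨0, Eventually.of_forall fun s => by simp [ladderPoly]⟩
  | succ n ih =>
    obtain ⟨B, hB⟩ := ih
    refine ⟨2 * (n + 1) / y, ?_⟩
    filter_upwards [(tendsto_atTop_add_const_right atTop (-1 : ℝ) tendsto_id).eventually hB,
      eventually_gt_atTop 0, eventually_ge_atTop ((n : ℝ) + 1),
      eventually_ge_atTop (1 + (1 + y ^ 2) * B / y)] with s hs hs0 hsn hsB
    rw [id, neg_add, neg_neg] at hs
    rw [derivative_ladderPoly_succ, ladderPoly]
    simp only [eval_sub, eval_mul, eval_C, eval_X, eval_one, eval_pow]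
    set p := (ladderPoly (-1) n (-s + 1)).eval y
    set p' := (derivative (ladderPoly (-1) n (-s + 1))).eval y
    obtain ⟨hp, -, hpB⟩ := hs
    have hsy : y + (1 + y ^ 2) * B ≤ s * y := by
      have := mul_le_mul_of_nonneg_right hsB hy.le
      rwa [add_mul, div_mul_cancel₀ _ hy.ne', one_mul] at this
    have lower : s * y * p ≤ -1 * (2 * -s + 1) * y * p - (1 - -1 * y ^ 2) * p' := by
      nlinarith [mul_le_mul_of_nonneg_right hsy hp.le,
        mul_le_mul_of_nonneg_left hpB (by positivity : 0 ≤ 1 + y ^ 2)]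
    refine ⟨lt_of_lt_of_le (by positivity) lower, mul_nonneg (by nlinarith) hp.le, ?_⟩
    calc -1 * (n + 1) * (n + 2 * -s + 1) * p ≤ (n + 1) * (2 * s) * p :=
          mul_le_mul_of_nonneg_right (by nlinarith) hp.le
      _ = 2 * (n + 1) / y * (s * y * p) := by field_simp
      _ ≤ _ := mul_le_mul_of_nonneg_left lower (by positivity)

lemma le_add_arctan_of_neg_mul_le {v v' k φ : ℝ} (hv : 0 < v) (hv' : -k * v ≤ v')
    (hφv : v' * sin φ = v * cos φ) (hφ : φ < (n + 1) * π) :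
    φ ≤ n * π + π / 2 + arctan k := by
  obtain ⟨δ, hδ⟩ : ∃ δ, φ = δ + π / 2 + n * π := ⟨φ - n * π - π / 2, by ring⟩
  rw [hδ, sin_add_nat_mul_pi, cos_add_nat_mul_pi, sin_add_pi_div_two, cos_add_pi_div_two] at hφv
  have hvδ : v' * cos δ = -(v * sin δ) :=
    mul_left_cancel₀ (pow_ne_zero n (by norm_num : (-1 : ℝ) ≠ 0)) (by linear_combination hφv)
  by_contra! hgt
  have hkδ : arctan k < δ := by linarith
  have hδ_mem : δ ∈ Ioo (-(π / 2)) (π / 2) :=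
    ⟨(neg_pi_div_two_lt_arctan k).trans hkδ, by linarith⟩
  have hcos := cos_pos_of_mem_Ioo hδ_mem
  have htan : k * cos δ < sin δ := by
    rwa [← arctan_tan hδ_mem.1 hδ_mem.2, arctan_lt_arctan_iff, tan_eq_sin_div_cos,
      lt_div_iff₀ hcos] at hkδ
  nlinarith [mul_le_mul_of_nonneg_right hv' hcos.le, mul_lt_mul_of_pos_left htan hv]

/-- Otherwise `φ` takes the values `0, π, …, n π` on `[-c, c]`, and `P` has too many roots. -/
lemma IsPruferAngle.lt_of_natDegree_le (hφ : IsPruferAngle Q φ) (hQ : Continuous Q)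
    (heven : Q.Even) (h0 : φ 0 = (n + 1) * π / 2) (hc : 0 ≤ c) {P : ℝ[X]} (hP0 : P ≠ 0)
    (hP : P.natDegree ≤ n) {f : ℝ → ℝ} (hf : f.Injective)
    (hroot : ∀ x, sin (φ x) = 0 → P.eval (f x) = 0) : φ c < (n + 1) * π := by
  by_contra! hge
  have hneg : φ (-c) ≤ 0 := by
    have := hφ.add_comp_neg hQ heven (k := n + 1) (by exact_mod_cast h0) hc
    push_cast at this
    linarith
  have hattain : ∀ i : Fin (n + 1), ∃ x, φ x = (i : ℕ) * π := fun i => by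
    have hi : ((i : ℕ) : ℝ) ≤ n + 1 := by exact_mod_cast i.2.le
    obtain ⟨x, -, hx⟩ := intermediate_value_Icc (neg_le_self hc) hφ.continuous.continuousOn
      ⟨hneg.trans (by positivity), (mul_le_mul_of_nonneg_right hi pi_pos.le).trans hge⟩
    exact ⟨x, hx⟩
  choose x hx using hattain
  have hinj : Function.Injective x := fun i j hij => by
    have h := hx i
    rw [hij, hx j, mul_left_inj' pi_ne_zero, Nat.cast_inj] at h
    exact Fin.ext h.symm
  refine hP0 (eq_zero_of_natDegree_lt_card_of_eval_eq_zero P (hf.comp hinj)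
    (fun i => hroot _ ?_) ?_)
  · rw [hx, sin_nat_mul_pi]
  · rw [Fintype.card_fin]
    omega

lemma continuous_modifiedPoschlTeller (n : ℕ) (s : ℝ) :
    Continuous fun x => s + n * (2 * s - n) - s * (s + 1) * tanh x ^ 2 := by
  have hcosh := fun x => (cosh_pos x).ne'
  simp only [tanh_eq_sinh_div_cosh]
  fun_prop (disch := exact hcosh _)

lemma IsPruferAngle.modifiedPoschlTeller_le
    (hφ : IsPruferAngle (fun x => s + n * (2 * s - n) - s * (s + 1) * tanh x ^ 2) φ)
    (h0 : φ 0 = (n + 1) * π / 2) (hc : 0 ≤ c) (hP : 0 < (ladderPoly (-1) n (-s)).eval (sinh c))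
    (hP' : 0 ≤ (derivative (ladderPoly (-1) n (-s))).eval (sinh c)) :
    φ c ≤ n * π + π / 2 + arctan (s * tanh c) := by
  have hQ := continuous_modifiedPoschlTeller n s
  have hsol := isSolution_modifiedPoschlTeller (gegenbauerEquation_ladderPoly (-1) n (-s))
  obtain ⟨hval, hderiv⟩ := eval_zero_ladderPoly_mul (-1) n (-s)
  set P := ladderPoly (-1) n (-s)
  have hφu := hφ.deriv_mul_sin_eq hQ hsol (x₀ := 0) (by
    simp only [h0, sinh_zero, cosh_zero, one_rpow, one_mul, hval]
    simpa using hderiv)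
  have hP0 : P ≠ 0 := fun h => by
    rw [h, eval_zero] at hP
    exact hP.false
  have hcosh (r : ℝ) : ∀ x, 0 < cosh x ^ r := fun x => rpow_pos_of_pos (cosh_pos x) r
  have hlt : φ c < (n + 1) * π := by
    refine hφ.lt_of_natDegree_le hQ (fun x => by simp only [tanh_neg, neg_sq]) h0 hc
      hP0 (natDegree_ladderPoly_le _ _ _) sinh_injective fun x hx => ?_
    have hcos : cos (φ x) ≠ 0 := fun h => by simpa [hx, h] using sin_sq_add_cos_sq (φ x)
    have hux := hφu x
    rw [hx, mul_zero, eq_comm, mul_eq_zero_iff_right hcos, mul_eq_zero] at hux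
    exact hux.resolve_left (hcosh (-s) x).ne'
  refine le_add_arctan_of_neg_mul_le (mul_pos (hcosh (-s) c) hP) ?_ (hφu c) hlt
  have hu' : 0 ≤ cosh c ^ (-s - 1) * ((1 + sinh c ^ 2) * (derivative P).eval (sinh c)) := by
    have := hcosh (-s - 1) c
    positivity
  have hpow : cosh c ^ (-s) = cosh c ^ (-s - 1) * cosh c := by
    rw [← rpow_add_one (cosh_pos c).ne', sub_add_cancel]
  have htanh : sinh c = tanh c * cosh c := by
    rw [tanh_eq_sinh_div_cosh, div_mul_cancel₀ _ (cosh_pos c).ne']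
  simp only [eval_add, eval_mul, eval_C, eval_X, eval_one, eval_pow]
  calc -(s * tanh c) * (cosh c ^ (-s) * P.eval (sinh c))
      = cosh c ^ (-s - 1) * (-s * sinh c * P.eval (sinh c)) := by
        rw [hpow]
        linear_combination s * cosh c ^ (-s - 1) * P.eval (sinh c) * htanh
    _ ≤ _ := by linarith

theorem IsPruferAngle.le_of_le_modifiedPoschlTeller (hθ : IsPruferAngle Q θ) (hQ : Continuous Q)
    (heven : Q.Even) {L : ℝ} (h0 : θ (-L) ≤ π / 2) (hc : 0 ≤ c) (hcL : c < L) (hs : 0 ≤ s)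
    (hP : 0 < (ladderPoly (-1) n (-s)).eval (sinh c))
    (hP' : 0 ≤ (derivative (ladderPoly (-1) n (-s))).eval (sinh c))
    (hnear : ∀ x ∈ Icc 0 c, Q x ≤ s + n * (2 * s - n) - s * (s + 1) * tanh x ^ 2)
    (hfar : ∀ x ∈ Icc c L, Q x ≤ -(s * tanh c / (L - c) + (s * tanh c) ^ 2)) :
    θ L ≤ n * π + π / 2 := by
  obtain ⟨ψ, hψ0, hψ⟩ := exists_isPruferAngle hQ 0 ((n + 1) * π / 2)
  obtain ⟨φ, hφ0, hφ⟩ := exists_isPruferAngle (continuous_modifiedPoschlTeller n s) 0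
    ((n + 1) * π / 2)
  have htanh : 0 ≤ s * tanh c := mul_nonneg hs (tanh_nonneg hc)
  have hψc : ψ c ≤ n * π + π / 2 + arctan (s * tanh c) :=
    (hψ.le_of_le hφ hQ hc hnear (by rw [hψ0, hφ0])).trans
      (hφ.modifiedPoschlTeller_le hφ0 hc hP hP')
  have hψL : ψ L ≤ n * π + π / 2 := by
    exact_mod_cast hψ.le_of_le_gaussian hQ hcL htanh hfar (n := n) (by exact_mod_cast hψc)
  have hL : 0 ≤ L := hc.trans hcL.le
  have hreflect := hψ.add_comp_neg hQ heven (k := n + 1) (by exact_mod_cast hψ0) hL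
  push_cast at hreflect
  exact (hθ.le_of_le hψ hQ (neg_le_self hL) (fun x _ => le_rfl) (by linarith)).trans hψL

end ModifiedPoschlTeller

end SturmLiouville

namespace TwoCenters

open Set Real SturmLiouville

section NthSmallest

lemma nthSmallest_range {g : ℕ → ℝ} (hg : StrictMono g) : nthSmallest (range g) = g := by
  funext n
  induction n with
  | zero =>
    refine IsLeast.csInf_eq ⟨⟨0, rfl⟩, ?_⟩
    rintro _ ⟨k, rfl⟩
    exact hg.monotone (Nat.zero_le k)
  | succ n ih =>
    rw [nthSmallest, ih]
    refine IsLeast.csInf_eq ⟨⟨⟨n + 1, rfl⟩, hg n.lt_succ_self⟩, ?_⟩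
    rintro _ ⟨⟨k, rfl⟩, hk⟩
    exact hg.monotone (hg.lt_iff_lt.1 hk)

lemma strictMono_nthSmallest_of_mem_iff {F : ℝ → ℝ} (hF : StrictMono F) (hFc : Continuous F)
    (htop : Tendsto F atTop atTop) {a c p : ℝ} (ha : F a ≤ c) (hp : 0 < p) {S : Set ℝ}
    (hS : ∀ μ, μ ∈ S ↔ ∃ k : ℕ, F μ = c + k * p) :
    StrictMono (nthSmallest S) ∧ range (nthSmallest S) = S ∧
      ∀ n, F (nthSmallest S n) = c + n * p := by
  have hex (k : ℕ) : c + k * p ∈ range F :=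
    mem_range_of_exists_le_of_exists_ge hFc ⟨a, ha.trans (le_add_of_nonneg_right (by positivity))⟩
      (htop.eventually_ge_atTop _).exists
  choose g hg using hex
  have hgmono : StrictMono g := fun i j hij => hF.lt_iff_lt.1 <| by
    rw [hg, hg]
    gcongr
  have hgS : S = range g := by
    ext μ
    simp only [hS, ← hg, hF.injective.eq_iff, mem_range, eq_comm]
  rw [hgS, nthSmallest_range hgmono]
  exact ⟨hgmono, rfl, hg⟩

end NthSmallest

section AngularPotential

variable {h E Zm μ : ℝ}

/-- The angular eigenvalue equation `K_η ψ = μ ψ` reads `ψ'' = -Q ψ` with this potential `Q`. -/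
noncomputable def angularPotential (h E Zm μ x : ℝ) : ℝ :=
  (μ - (Zm * cos x + E * cos x ^ 2)) / h ^ 2

lemma continuous_angularPotential (h E Zm μ : ℝ) : Continuous (angularPotential h E Zm μ) := by
  unfold angularPotential
  fun_prop

lemma even_angularPotential (h E Zm μ : ℝ) : (angularPotential h E Zm μ).Even := fun x => by
  simp only [angularPotential, cos_neg]

lemma periodic_angularPotential (h E Zm μ : ℝ) :
    (angularPotential h E Zm μ).Periodic (2 * π) := fun x => by
  simp only [angularPotential, cos_add_two_pi]

lemma angularPotential_sub_angularPotential (h E Zm μ ν x : ℝ) :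
    angularPotential h E Zm ν x - angularPotential h E Zm μ x = (ν - μ) / h ^ 2 := by
  rw [angularPotential, angularPotential, ← sub_div, sub_sub_sub_cancel_right]

lemma abs_mul_cos_add_mul_cos_sq_le (E Zm x : ℝ) :
    |Zm * cos x + E * cos x ^ 2| ≤ |Zm| + |E| := by
  refine (abs_add_le _ _).trans (add_le_add ?_ ?_) <;> rw [abs_mul]
  · exact mul_le_of_le_one_right (abs_nonneg _) (abs_cos_le_one x)
  · rw [abs_sq]
    exact mul_le_of_le_one_right (abs_nonneg _) (cos_sq_le_one x)

lemma isAngularEigenfunction_iff (hh : h ≠ 0) {ψ : ℝ → ℝ} : IsAngularEigenfunction h E Zm μ ψ ↔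
    (∃ ψ', IsSolution (angularPotential h E Zm μ) ψ ψ') ∧ ψ.Periodic (2 * π) ∧ ψ ≠ 0 := by
  refine ⟨fun hψ => ⟨⟨deriv ψ, fun x => ⟨?_, ?_⟩⟩, hψ.periodic, hψ.ne_zero⟩, ?_⟩
  · exact (hψ.contDiff.differentiable (by norm_num) x).hasDerivAt
  · have hderiv : ContDiff ℝ 1 (deriv ψ) := (contDiff_succ_iff_deriv.1 hψ.contDiff).2.2
    refine (hderiv.differentiable (by norm_num) x).hasDerivAt.congr_deriv ?_
    have heigen := hψ.eigen x
    rw [angularOp] at heigen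
    rw [angularPotential]
    field_simp
    linear_combination -heigen
  · rintro ⟨⟨ψ', hψ⟩, hper, hne⟩
    have hderiv : deriv ψ = ψ' := funext fun x => (hψ x).1.deriv
    have hderiv' : deriv ψ' = fun x => -angularPotential h E Zm μ x * ψ x :=
      funext fun x => (hψ x).2.deriv
    refine ⟨?_, hper, hne, fun x => ?_⟩
    · refine contDiff_succ_iff_deriv (n := 1).2
        ⟨fun x => (hψ x).1.differentiableAt, by simp, hderiv ▸ contDiff_one_iff_deriv.2
          ⟨fun x => (hψ x).2.differentiableAt, hderiv' ▸ ?_⟩⟩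
      exact (continuous_angularPotential h E Zm μ).neg.mul hψ.continuous
    · simp only [angularOp, hderiv, hderiv', angularPotential]
      field_simp
      ring

end AngularPotential

section AngularAngle

variable {h E Zm α β μ : ℝ}

lemma exists_angularAngle (h E Zm α μ : ℝ) :
    ∃ θ : ℝ → ℝ, θ 0 = α ∧ IsPruferAngle (angularPotential h E Zm μ) θ :=
  exists_isPruferAngle (continuous_angularPotential h E Zm μ) 0 α

/-- The Prüfer angle of the angular equation at energy `μ` with value `α` at `0`. -/
noncomputable def angularAngle (h E Zm α μ : ℝ) : ℝ → ℝ :=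
  (exists_angularAngle h E Zm α μ).choose

lemma angularAngle_zero (h E Zm α μ : ℝ) : angularAngle h E Zm α μ 0 = α :=
  (exists_angularAngle h E Zm α μ).choose_spec.1

lemma isPruferAngle_angularAngle (h E Zm α μ : ℝ) :
    IsPruferAngle (angularPotential h E Zm μ) (angularAngle h E Zm α μ) :=
  (exists_angularAngle h E Zm α μ).choose_spec.2

lemma strictMono_angularAngle_pi (hh : h ≠ 0) (E Zm α : ℝ) :
    StrictMono fun μ => angularAngle h E Zm α μ π := fun μ ν hμν =>
  (isPruferAngle_angularAngle h E Zm α μ).lt_of_le (isPruferAngle_angularAngle h E Zm α ν)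
    (continuous_angularPotential h E Zm μ) pi_pos
    (fun x _ => sub_pos.1 <| by
      rw [angularPotential_sub_angularPotential]
      exact div_pos (sub_pos.2 hμν) (by positivity))
    (by rw [angularAngle_zero, angularAngle_zero])

lemma continuous_angularAngle_pi (h E Zm α : ℝ) :
    Continuous fun μ => angularAngle h E Zm α μ π := by
  refine continuous_iff_continuousAt.2 fun μ => tendsto_iff_dist_tendsto_zero.2 ?_
  obtain ⟨M, hM⟩ := isCompact_Icc.exists_bound_of_continuousOn (s := Icc 0 π)
    (continuous_angularPotential h E Zm μ).continuousOn
  have hbound (ν : ℝ) : dist (angularAngle h E Zm α ν π) (angularAngle h E Zm α μ π) ≤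
      gronwallBound 0 (M.toNNReal + 1) (|ν - μ| / h ^ 2) (π - 0) := by
    refine (isPruferAngle_angularAngle h E Zm α μ).abs_sub_le
      (isPruferAngle_angularAngle h E Zm α ν) pi_pos.le
      (by rw [angularAngle_zero, angularAngle_zero])
      (fun x hx => (hM x hx).trans M.le_coe_toNNReal) fun x _ => ?_
    rw [angularPotential_sub_angularPotential, abs_div, abs_sq]
  refine squeeze_zero (fun _ => dist_nonneg) hbound ?_
  have hcont : Continuous fun ν => gronwallBound 0 (M.toNNReal + 1) (|ν - μ| / h ^ 2) (π - 0) :=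
    (gronwallBound_continuous_ε _ _ _).comp (by fun_prop)
  simpa [gronwallBound_ε0] using hcont.tendsto μ

lemma angularAngle_pi_pos (hα : 0 ≤ α) : 0 < angularAngle h E Zm α μ π := by
  simpa using (isPruferAngle_angularAngle h E Zm α μ).int_mul_pi_lt (k := 0) pi_pos
    (by simpa [angularAngle_zero] using hα)

lemma angularAngle_pi_le_angularAngle_pi (hαβ : α ≤ β) :
    angularAngle h E Zm α μ π ≤ angularAngle h E Zm β μ π :=
  (isPruferAngle_angularAngle h E Zm α μ).le_of_le (isPruferAngle_angularAngle h E Zm β μ)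
    (continuous_angularPotential h E Zm μ) pi_pos.le (fun _ _ => le_rfl)
    (by rwa [angularAngle_zero, angularAngle_zero])

lemma angularAngle_neg_abs_add_abs_pi_le (h E Zm : ℝ) (hα : α ≤ π / 2) :
    angularAngle h E Zm α (-(|Zm| + |E|)) π ≤ π / 2 := by
  have hconst : IsPruferAngle (fun _ => 0) fun _ => π / 2 := fun x => by
    simpa using hasDerivAt_const x (π / 2)
  refine (isPruferAngle_angularAngle h E Zm α _).le_of_le hconst
    (continuous_angularPotential h E Zm _) pi_pos.le (fun x _ => ?_)
    ((angularAngle_zero h E Zm α _).trans_le hα)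
  exact div_nonpos_of_nonpos_of_nonneg
    (by linarith [(abs_le.1 (abs_mul_cos_add_mul_cos_sq_le E Zm x)).1]) (sq_nonneg h)

lemma tendsto_angularAngle_pi_atTop (hh : h ≠ 0) (E Zm : ℝ) (hα : 0 ≤ α) :
    Tendsto (fun μ => angularAngle h E Zm α μ π) atTop atTop := by
  refine tendsto_atTop_atTop_of_monotone (strictMono_angularAngle_pi hh E Zm α).monotone fun b => ?_
  obtain ⟨n, hn⟩ := exists_nat_ge (b / π)
  have hbn : b ≤ (n + 1) * π := ((div_le_iff₀ pi_pos).1 hn).trans (by gcongr; linarith)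
  refine ⟨|Zm| + |E| + (3 + n * (n + 2 * 2)) * h ^ 2, hbn.trans ?_⟩
  refine (isPruferAngle_angularAngle h E Zm α _).succ_mul_pi_le_of_poschlTeller_lt
    (continuous_angularPotential h E Zm _) (hα.trans_eq (angularAngle_zero h E Zm α _).symm)
    one_lt_two n fun x _ => ?_
  rw [angularPotential, lt_div_iff₀ (by positivity)]
  have hh2 : 0 < h ^ 2 := by positivity
  have hcot := mul_nonneg (sq_nonneg (cos x / sin x)) hh2.le
  linarith [(abs_le.1 (abs_mul_cos_add_mul_cos_sq_le E Zm x)).2]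

lemma sin_sub_eq_zero_iff_exists_nat {x c : ℝ} (hx : c - π < x) :
    sin (x - c) = 0 ↔ ∃ k : ℕ, x = c + k * π := by
  rw [sin_eq_zero_iff]
  constructor
  · rintro ⟨k, hk⟩
    have hk0 : (-1 : ℝ) < k := lt_of_mul_lt_mul_right (by linarith) pi_pos.le
    lift k to ℕ using Int.lt_iff_add_one_le.1 (by exact_mod_cast hk0)
    exact ⟨k, by rw [Int.cast_natCast] at hk; linarith⟩
  · rintro ⟨k, rfl⟩
    exact ⟨k, by rw [add_sub_cancel_left, Int.cast_natCast]⟩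

lemma mem_evenSpectrum_iff (hh : h ≠ 0) :
    μ ∈ evenSpectrum h E Zm ↔ ∃ k : ℕ, angularAngle h E Zm (π / 2) μ π = π / 2 + k * π := by
  have hQ := continuous_angularPotential h E Zm μ
  have hpos : 0 < angularAngle h E Zm (π / 2) μ π := angularAngle_pi_pos (by positivity)
  rw [← sin_sub_eq_zero_iff_exists_nat (by linarith [pi_pos]),
    ← (isPruferAngle_angularAngle h E Zm (π / 2) μ).exists_boundary_solution_iff hQ
      (angularAngle_zero h E Zm _ μ)]
  simp only [evenSpectrum, mem_ofPred_eq, isAngularEigenfunction_iff hh, sin_pi_div_two,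
    cos_pi_div_two, mul_one, mul_zero]
  have hiff {y y'} (hy : IsSolution (angularPotential h E Zm μ) y y') :=
    hy.even_and_periodic_iff hQ (even_angularPotential h E Zm μ)
      (periodic_angularPotential h E Zm μ)
  constructor
  · rintro ⟨y, ⟨⟨y', hy⟩, hper, hne⟩, heven⟩
    exact ⟨y, y', hy, hne, (hiff hy).1 ⟨heven, hper⟩⟩
  · rintro ⟨y, y', hy, hne, hbc⟩
    exact ⟨y, ⟨⟨y', hy⟩, ((hiff hy).2 hbc).2, hne⟩, ((hiff hy).2 hbc).1⟩

lemma mem_oddSpectrum_iff (hh : h ≠ 0) :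
    μ ∈ oddSpectrum h E Zm ↔ ∃ k : ℕ, angularAngle h E Zm 0 μ π = π + k * π := by
  have hQ := continuous_angularPotential h E Zm μ
  have hpos : 0 < angularAngle h E Zm 0 μ π := angularAngle_pi_pos le_rfl
  rw [← sin_sub_eq_zero_iff_exists_nat (by linarith), sin_sub_pi, neg_eq_zero,
    ← sub_zero (angularAngle h E Zm 0 μ π),
    ← (isPruferAngle_angularAngle h E Zm 0 μ).exists_boundary_solution_iff hQ
      (angularAngle_zero h E Zm _ μ)]
  simp only [oddSpectrum, mem_ofPred_eq, isAngularEigenfunction_iff hh, sin_zero, cos_zero, mul_one,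
    mul_zero, @eq_comm ℝ 0]
  have hiff {y y'} (hy : IsSolution (angularPotential h E Zm μ) y y') :=
    hy.odd_and_periodic_iff hQ (even_angularPotential h E Zm μ)
      (periodic_angularPotential h E Zm μ)
  constructor
  · rintro ⟨y, ⟨⟨y', hy⟩, hper, hne⟩, hodd⟩
    exact ⟨y, y', hy, hne, (hiff hy).1 ⟨hodd, hper⟩⟩
  · rintro ⟨y, y', hy, hne, hbc⟩
    exact ⟨y, ⟨⟨y', hy⟩, ((hiff hy).2 hbc).2, hne⟩, ((hiff hy).2 hbc).1⟩

end AngularAngle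

section Eigenvalues

variable {h E s : ℝ}

theorem muPlus_spec (hh : h ≠ 0) (E Zm : ℝ) :
    StrictMono (fun n => muPlus n h E Zm) ∧
      range (fun n => muPlus n h E Zm) = evenSpectrum h E Zm ∧
      ∀ n : ℕ, angularAngle h E Zm (π / 2) (muPlus n h E Zm) π = π / 2 + n * π :=
  strictMono_nthSmallest_of_mem_iff (strictMono_angularAngle_pi hh E Zm _)
    (continuous_angularAngle_pi h E Zm _) (tendsto_angularAngle_pi_atTop hh E Zm (by positivity))
    (angularAngle_neg_abs_add_abs_pi_le h E Zm le_rfl) pi_pos fun _ => mem_evenSpectrum_iff hh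

theorem muMinus_spec (hh : h ≠ 0) (E Zm : ℝ) :
    StrictMono (fun n => muMinus n h E Zm) ∧
      range (fun n => muMinus n h E Zm) = oddSpectrum h E Zm ∧
      ∀ n : ℕ, angularAngle h E Zm 0 (muMinus n h E Zm) π = π + n * π :=
  strictMono_nthSmallest_of_mem_iff (strictMono_angularAngle_pi hh E Zm _)
    (continuous_angularAngle_pi h E Zm _) (tendsto_angularAngle_pi_atTop hh E Zm le_rfl)
    ((angularAngle_neg_abs_add_abs_pi_le h E Zm (by positivity)).trans (half_le_self pi_pos.le))
    pi_pos fun _ => mem_oddSpectrum_iff hh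

lemma le_muPlus_of_angularAngle_le (hh : h ≠ 0) {E Zm μ : ℝ} {n : ℕ}
    (hμ : angularAngle h E Zm (π / 2) μ π ≤ n * π + π / 2) : μ ≤ muPlus n h E Zm := by
  rw [← (strictMono_angularAngle_pi hh E Zm (π / 2)).le_iff_le]
  exact hμ.trans_eq (((muPlus_spec hh E Zm).2.2 n).trans (add_comm _ _)).symm

lemma muMinus_le_of_le_angularAngle (hh : h ≠ 0) {E Zm μ : ℝ} {n : ℕ}
    (hμ : (n + 1) * π ≤ angularAngle h E Zm 0 μ π) : muMinus n h E Zm ≤ μ := by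
  rw [← (strictMono_angularAngle_pi hh E Zm 0).le_iff_le]
  exact (((muMinus_spec hh E Zm).2.2 n).trans (by ring)).trans_le hμ

lemma muPlus_le_muMinus (hh : h ≠ 0) (E Zm : ℝ) (n : ℕ) :
    muPlus n h E Zm ≤ muMinus n h E Zm := by
  rw [← (strictMono_angularAngle_pi hh E Zm (π / 2)).le_iff_le]
  simp only [(muPlus_spec hh E Zm).2.2]
  calc π / 2 + n * π ≤ π + n * π := by linarith [pi_pos]
    _ = angularAngle h E Zm 0 (muMinus n h E Zm) π := ((muMinus_spec hh E Zm).2.2 n).symm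
    _ ≤ _ := angularAngle_pi_le_angularAngle_pi (by positivity)

lemma cos_sq_le_cos_div_sin_sq {x : ℝ} (hx : sin x ≠ 0) : cos x ^ 2 ≤ (cos x / sin x) ^ 2 := by
  rw [div_pow]
  exact le_div_self (sq_nonneg _) (by positivity) (sin_sq_le_one x)

lemma muMinus_le_of_le_poschlTeller (hh : h ≠ 0) (hs : 1 < s) (hE : E ≤ h ^ 2 * (s * (s - 1)))
    (n : ℕ) : muMinus n h E 0 ≤ h ^ 2 * (s + n * (n + 2 * s)) := by
  refine le_of_forall_gt_imp_ge_of_dense fun μ hμ => muMinus_le_of_le_angularAngle hh ?_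
  refine (isPruferAngle_angularAngle h E 0 0 μ).succ_mul_pi_le_of_poschlTeller_lt
    (continuous_angularPotential h E 0 μ) (angularAngle_zero h E 0 0 μ).ge hs n fun x hx => ?_
  have hwell : E * cos x ^ 2 ≤ h ^ 2 * (s * (s - 1)) * (cos x / sin x) ^ 2 :=
    mul_le_mul hE (cos_sq_le_cos_div_sin_sq (sin_pos_of_mem_Ioo hx).ne') (sq_nonneg _)
      (mul_nonneg (sq_nonneg h) (mul_nonneg (by linarith) (by linarith)))
  rw [angularPotential, lt_div_iff₀ (by positivity)]
  linarith

theorem muMinus_le (hh : 0 < h) (hE : 0 < E) (n : ℕ) :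
    muMinus n h E 0 ≤ (2 * n + 1) * √E * h + (n + 1) ^ 2 * h ^ 2 := by
  have hah : √E / h * h = √E := div_mul_cancel₀ _ hh.ne'
  have ha : 0 < √E / h := by positivity
  set a := √E / h
  have hEa : E = h ^ 2 * a ^ 2 := by rw [← sq_sqrt hE.le, ← hah]; ring
  calc muMinus n h E 0 ≤ h ^ 2 * (a + 1 + n * (n + 2 * (a + 1))) :=
        muMinus_le_of_le_poschlTeller hh.ne' (by linarith) (by rw [hEa]; gcongr; nlinarith) n
    _ = (2 * n + 1) * √E * h + (n + 1) ^ 2 * h ^ 2 := by rw [← hah]; ring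

/-- Near the well at `π / 2` the potential is compared with `tanh²`, away from it with a
constant. -/
lemma le_muPlus_of_modifiedPoschlTeller_le (hh : h ≠ 0) (hs : 0 ≤ s)
    (hE : h ^ 2 * (s * (s + 1)) ≤ E) {n : ℕ}
    (hP : 0 < (ladderPoly (-1) n (-s)).eval (sinh 1))
    (hP' : 0 ≤ (Polynomial.derivative (ladderPoly (-1) n (-s))).eval (sinh 1))
    (hgap : h ^ 2 * (s * tanh 1 / (π / 2 - 1) + (s * tanh 1) ^ 2 + (s + n * (2 * s - n))) ≤
      E * sin 1 ^ 2) :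
    h ^ 2 * (s + n * (2 * s - n)) ≤ muPlus n h E 0 := by
  set μ := h ^ 2 * (s + n * (2 * s - n)) with hμ
  have hh2 : 0 < h ^ 2 := by positivity
  have hE0 : 0 ≤ E := le_trans (by positivity) hE
  have hshift : IsPruferAngle (fun x => (μ - E * sin x ^ 2) / h ^ 2)
      (fun x => angularAngle h E 0 (π / 2) μ (x + π / 2)) := fun x => by
    refine ((isPruferAngle_angularAngle h E 0 (π / 2) μ _).comp_add_const x _).congr_deriv ?_
    rw [angularPotential, cos_add_pi_div_two, neg_sq, zero_mul, zero_add]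
  have hangle := hshift.le_of_le_modifiedPoschlTeller (n := n) (L := π / 2) (c := 1) (s := s)
    (by fun_prop) (fun x => by simp only [sin_neg, neg_sq])
    (by rw [neg_add_cancel, angularAngle_zero]) zero_le_one
    (by linarith [pi_gt_three]) hs hP hP' (fun x hx => ?_) (fun x hx => ?_)
  · rw [add_halves] at hangle
    exact le_muPlus_of_angularAngle_le hh hangle
  · have hwell : h ^ 2 * (s * (s + 1)) * tanh x ^ 2 ≤ E * sin x ^ 2 :=
      mul_le_mul hE (pow_le_pow_left₀ (tanh_nonneg hx.1) (tanh_le_sin hx) 2) (sq_nonneg _) hE0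
    rw [div_le_iff₀ hh2]
    linarith [hμ]
  · have hsin : sin 1 ≤ sin x := sin_le_sin_of_le_of_le_pi_div_two (by linarith [pi_pos]) hx.2 hx.1
    have hsin1 : 0 ≤ sin 1 := (tanh_nonneg zero_le_one).trans tanh_one_lt_sin_one.le
    have hwall : E * sin 1 ^ 2 ≤ E * sin x ^ 2 := by gcongr
    rw [div_le_iff₀ hh2]
    linarith [hμ]

lemma eventually_gap (n : ℕ) : ∀ᶠ a : ℝ in atTop,
    (a - 1 / 2) * tanh 1 / (π / 2 - 1) + ((a - 1 / 2) * tanh 1) ^ 2 +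
      (a - 1 / 2 + n * (2 * (a - 1 / 2) - n)) ≤ a ^ 2 * sin 1 ^ 2 := by
  have htanh : 0 ≤ tanh 1 := tanh_nonneg zero_le_one
  have hgap : 0 < sin 1 ^ 2 - tanh 1 ^ 2 :=
    sub_pos.2 (pow_lt_pow_left₀ tanh_one_lt_sin_one htanh two_ne_zero)
  have hpi : 0 < π / 2 - 1 := by linarith [pi_gt_three]
  filter_upwards [eventually_ge_atTop (1 / 2), eventually_ge_atTop
    ((tanh 1 / (π / 2 - 1) + (2 * n + 1)) / (sin 1 ^ 2 - tanh 1 ^ 2))] with a ha hgrowth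
  rw [div_le_iff₀ hgap] at hgrowth
  have hlinear : (a - 1 / 2) * tanh 1 / (π / 2 - 1) ≤ a * (tanh 1 / (π / 2 - 1)) := by
    rw [mul_div_assoc]
    gcongr
    linarith
  have hsq : ((a - 1 / 2) * tanh 1) ^ 2 ≤ (a * tanh 1) ^ 2 := by
    have : 0 ≤ a - 1 / 2 := by linarith
    gcongr
    linarith
  have hshift : a - 1 / 2 + n * (2 * (a - 1 / 2) - n) ≤ a * (2 * n + 1) := by
    nlinarith [sq_nonneg (n : ℝ)]
  nlinarith [mul_le_mul_of_nonneg_left hgrowth (by linarith : 0 ≤ a)]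

theorem eventually_le_muPlus (hE : 0 < E) (n : ℕ) : ∀ᶠ h in 𝓝[>] (0 : ℝ),
    (2 * n + 1) * √E * h - (n ^ 2 + n + 1 / 2) * h ^ 2 ≤ muPlus n h E 0 := by
  obtain ⟨_, hladder⟩ := eventually_ladderPoly_neg_bound n (sinh_pos_iff.2 one_pos)
  have ha_top : Tendsto (fun h => √E / h) (𝓝[>] 0) atTop :=
    tendsto_inv_nhdsGT_zero.const_mul_atTop (sqrt_pos.2 hE)
  filter_upwards [self_mem_nhdsWithin, ha_top.eventually (eventually_ge_atTop (1 / 2)),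
    ha_top.eventually (eventually_gap n),
    ha_top.eventually ((tendsto_atTop_add_const_right atTop (-(1 / 2)) tendsto_id).eventually
      hladder)] with h (hh : 0 < h) ha hgap hP
  have hah : √E / h * h = √E := div_mul_cancel₀ _ hh.ne'
  set a := √E / h
  have hEa : E = h ^ 2 * a ^ 2 := by rw [← sq_sqrt hE.le, ← hah]; ring
  calc (2 * n + 1) * √E * h - (n ^ 2 + n + 1 / 2) * h ^ 2
      = h ^ 2 * (a - 1 / 2 + n * (2 * (a - 1 / 2) - n)) := by rw [← hah]; ring
    _ ≤ muPlus n h E 0 := by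
      refine le_muPlus_of_modifiedPoschlTeller_le hh.ne' (sub_nonneg.2 ha) ?_ hP.1 hP.2.1 ?_
      · rw [hEa]
        gcongr
        nlinarith
      · rw [hEa, mul_assoc]
        gcongr

end Eigenvalues

lemma isBigO_of_le_of_le {ι : Type*} {l : Filter ι} {f g : ι → ℝ} (A B : ℝ)
    (hA : ∀ᶠ x in l, A * g x ≤ f x) (hB : ∀ᶠ x in l, f x ≤ B * g x) : f =O[l] g := by
  refine IsBigO.of_bound (max |A| |B|) ?_
  filter_upwards [hA, hB] with x hAx hBx
  rw [norm_eq_abs, norm_eq_abs, max_mul_of_nonneg _ _ (abs_nonneg _), ← abs_mul, ← abs_mul]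
  exact abs_le_max_abs_abs hAx hBx

end TwoCenters

/-- Equal charges, `Z₋ = 0`. The first two parts say that `μ_0^± < μ_1^± < ⋯` are really all the
eigenvalues of the respective parity; the last part is their behaviour as `h ↘ 0`. -/
theorem corollary6p2 (E : ℝ) (hE : 0 < E) :
    (∀ h : ℝ, 0 < h → StrictMono (fun n : ℕ => TwoCenters.muPlus n h E 0) ∧
      Set.range (fun n : ℕ => TwoCenters.muPlus n h E 0) = TwoCenters.evenSpectrum h E 0) ∧
    (∀ h : ℝ, 0 < h → StrictMono (fun n : ℕ => TwoCenters.muMinus n h E 0) ∧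
      Set.range (fun n : ℕ => TwoCenters.muMinus n h E 0) = TwoCenters.oddSpectrum h E 0) ∧
    ∀ n : ℕ,
      ((fun h : ℝ => TwoCenters.muPlus n h E 0 - (2 * (n : ℝ) + 1) * Real.sqrt E * h)
        =O[𝓝[>] (0 : ℝ)] fun h : ℝ => h ^ 2) ∧
      ((fun h : ℝ => TwoCenters.muMinus n h E 0 - (2 * (n : ℝ) + 1) * Real.sqrt E * h)
        =O[𝓝[>] (0 : ℝ)] fun h : ℝ => h ^ 2) := by
  refine ⟨fun h hh => ?_, fun h hh => ?_, fun n => ?_⟩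
  · have ⟨mono, range_eq, _⟩ := TwoCenters.muPlus_spec hh.ne' E 0
    exact ⟨mono, range_eq⟩
  · have ⟨mono, range_eq, _⟩ := TwoCenters.muMinus_spec hh.ne' E 0
    exact ⟨mono, range_eq⟩
  have lower : ∀ᶠ h in 𝓝[>] (0 : ℝ), -(n ^ 2 + n + 1 / 2 : ℝ) * h ^ 2 ≤
      TwoCenters.muPlus n h E 0 - (2 * n + 1) * Real.sqrt E * h := by
    filter_upwards [TwoCenters.eventually_le_muPlus hE n] with h hle
    linarith
  have upper : ∀ᶠ h in 𝓝[>] (0 : ℝ),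
      TwoCenters.muMinus n h E 0 - (2 * n + 1) * Real.sqrt E * h ≤ (n + 1 : ℝ) ^ 2 * h ^ 2 := by
    filter_upwards [self_mem_nhdsWithin] with h hh
    linarith [TwoCenters.muMinus_le hh hE n]
  have plus_le_minus : ∀ᶠ h in 𝓝[>] (0 : ℝ),
      TwoCenters.muPlus n h E 0 - (2 * n + 1) * Real.sqrt E * h ≤
        TwoCenters.muMinus n h E 0 - (2 * n + 1) * Real.sqrt E * h := by
    filter_upwards [self_mem_nhdsWithin] with h hh
    exact sub_le_sub_right (TwoCenters.muPlus_le_muMinus (ne_of_gt hh) E 0 n) _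
  exact ⟨TwoCenters.isBigO_of_le_of_le _ _ lower (plus_le_minus.mp (upper.mono fun _ => ge_trans)),
    TwoCenters.isBigO_of_le_of_le _ _ (lower.mp (plus_le_minus.mono fun _ => ge_trans)) upper⟩
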